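/- Let $K$ be a compact Lie group with a faithful unitary representation $\rho\colon K\to U(W)$ on a finite-dimensional Hermitian vector space $W$. Let $\mathfrak k=\{s\in\operatorname{End}(W) : \exp(ts)\in\rho(K)\ \forall t\in\mathbb R\}$ be its Lie algebra, let $\mathfrak g=\mathfrak k\oplus i\mathfrak k$, and let $G=K^{\mathbb C}\subseteq GL(W)$ be the complexification of $K$, i.e. the subgroup generated by $\rho(K)$ and $\exp\mathfrak g$. Let $F$ be a finite-dimensional (Hausdorff) complex manifold with a Kähler form $\omega$ (a smooth closed real 2-form, invariant under the complex structure $I$, with $\langle u,v\rangle=\omega(u,Iv)$ positive definite). Let $K$ act on $F$ preserving $\omega$, let this action be extended to a holomorphic action of $G$ on $F$, and let $\mu\colon F\to\mathfrak k^*$ be a moment map: $\mu$ is smooth, $d\mu_s=\omega(X_s,\cdot)$ for every $s\in\mathfrak k$, where $\mu_s=\langle\mu,s\rangle$ and $X_s(x)=\frac{d}{dt}\big|_{t=0}e^{ts}x$, and $\mu$ is equivariant for the coadjoint action of $K$ on $\mathfrak k^*$. For $x\in F$ and $s\in\mathfrak k$ put $\lambda_t(x;s)=\mu_s(e^{its}x)$,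 $t\in\mathbb R$. The limit $\lambda(x;s)=\lim_{t\to\infty}\lambda_t(x;s)\in\mathbb R\cup\{\infty\}$ exists as an extended real number; it is called the maximal weight of $s$ acting on $x$. The point $x$ is called analytically stable if $\lambda(x;s)>0$ for every nonzero $s\in\mathfrak k$. Let $x\in F$ be any point. Then there is at most one $K$-orbit inside the orbit $Gx$ on which the moment map vanishes. Furthermore, $x$ is analytically stable if and only if (1) the stabiliser $G_x$ of $x$ in $G$ is finite and (2) there exists a $K$-orbit inside $Gx$ on which the moment map vanishes. -/

import Mathlib

open scoped Manifold ContDiff Topology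

noncomputable section

namespace KempfNess

/-! ### Compact groups of unitary operators and their complexification -/

section Group

variable {W : Type*} [NormedAddCommGroup W] [InnerProductSpace ℂ W] [CompleteSpace W]

/-- The exponential of an endomorphism of `W`, as an element of `GL(W)`. -/
def expUnit (a : W →L[ℂ] W) : (W →L[ℂ] W)ˣ where
  val := NormedSpace.exp a
  inv := NormedSpace.exp (-a)
  val_inv := by
    let _ : NormedAlgebra ℚ (W →L[ℂ] W) := NormedAlgebra.restrictScalars ℚ ℂ (W →L[ℂ] W)
    rw [← NormedSpace.exp_add_of_commute (Commute.neg_right (Commute.refl a))]; simp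
  inv_val := by
    let _ : NormedAlgebra ℚ (W →L[ℂ] W) := NormedAlgebra.restrictScalars ℚ ℂ (W →L[ℂ] W)
    rw [← NormedSpace.exp_add_of_commute (Commute.neg_left (Commute.refl a))]; simp

variable {K : Type*} [Group K] [TopologicalSpace K]

/-- The unitary representation `ρ : K → U(W)` as a homomorphism into `GL(W)`. -/
def toGL (ρ : K →ₜ* unitary (W →L[ℂ] W)) : K →* (W →L[ℂ] W)ˣ :=
  Unitary.toUnits.comp (ρ : K →* unitary (W →L[ℂ] W))

theorem norm_toGL_le (ρ : K →ₜ* unitary (W →L[ℂ] W)) (k : K) :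
    ‖((toGL ρ k : (W →L[ℂ] W)ˣ) : W →L[ℂ] W)‖ ≤ 1 := by
  have h := (ρ k).2
  rw [Unitary.mem_iff] at h
  have h1 : ‖star (ρ k : W →L[ℂ] W) * (ρ k : W →L[ℂ] W)‖ ≤ 1 := by
    rw [h.1]; exact ContinuousLinearMap.norm_id_le
  rw [CStarRing.norm_star_mul_self] at h1
  have : ‖(ρ k : W →L[ℂ] W)‖ ≤ 1 := by nlinarith [norm_nonneg (ρ k : W →L[ℂ] W)]
  exact this

theorem isClosed_range_toGL [CompactSpace K] (ρ : K →ₜ* unitary (W →L[ℂ] W)) :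
    IsClosed (Set.range fun k : K => ((toGL ρ k : (W →L[ℂ] W)ˣ) : W →L[ℂ] W)) := by
  have hc : Continuous fun k : K => ((toGL ρ k : (W →L[ℂ] W)ˣ) : W →L[ℂ] W) :=
    continuous_subtype_val.comp ρ.continuous_toFun
  exact (isCompact_range hc).isClosed

/-- If `c` is a curve in the compact group `ρ(K)` with `c 0 = 1` and `c' 0 = v`, then
`exp v ∈ ρ(K)`. -/
theorem exp_mem_range_of_hasDerivAt [CompactSpace K] (ρ : K →ₜ* unitary (W →L[ℂ] W))
    (c : ℝ → K) (v : W →L[ℂ] W) (hc0 : c 0 = 1)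
    (hc : HasDerivAt (fun t => ((toGL ρ (c t) : (W →L[ℂ] W)ˣ) : W →L[ℂ] W)) v 0) :
    ∃ k : K, ((toGL ρ k : (W →L[ℂ] W)ˣ) : W →L[ℂ] W) = NormedSpace.exp v := by
  set A : ℝ → W →L[ℂ] W := fun t => ((toGL ρ (c t) : (W →L[ℂ] W)ˣ) : W →L[ℂ] W) with hA
  set B : ℝ → W →L[ℂ] W := fun t => NormedSpace.exp (t • v) with hB
  have hBd : HasDerivAt B v 0 := by
    have := hasDerivAt_exp_smul_const (𝕂 := ℝ) v (0 : ℝ)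
    simpa [hB] using this
  have hBc : Continuous B := by
    refine continuous_iff_continuousAt.2 fun t => ?_
    exact (hasDerivAt_exp_smul_const (𝕂 := ℝ) v t).continuousAt
  obtain ⟨M, hM⟩ := (isCompact_Icc (a := (0 : ℝ)) (b := 1)).exists_bound_of_continuousOn
    hBc.continuousOn
  have hpow : ∀ (t : ℝ) (j : ℕ), B t ^ j = B (j * t) := by
    intro t j
    let _ : NormedAlgebra ℚ (W →L[ℂ] W) := NormedAlgebra.restrictScalars ℚ ℂ (W →L[ℂ] W)
    simp only [hB]
    rw [← NormedSpace.exp_nsmul, mul_smul, Nat.cast_smul_eq_nsmul]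
  have hM0 : 0 ≤ M := (norm_nonneg _).trans (hM 0 (by simp))
  have key : ∀ n : ℕ, 0 < n → ∀ j ≤ n,
      ‖A (1 / n) ^ j - B (1 / n) ^ j‖ ≤ j * (M * ‖A (1 / n) - B (1 / n)‖) := by
    intro n hn j
    induction j with
    | zero => simp
    | succ j ih =>
      intro hj
      have ih' := ih (by omega)
      have e : A (1 / n) ^ (j + 1) - B (1 / n) ^ (j + 1)
          = A (1 / n) * (A (1 / n) ^ j - B (1 / n) ^ j)
            + (A (1 / n) - B (1 / n)) * B (1 / n) ^ j := by
        rw [pow_succ', pow_succ']; noncomm_ring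
      have hb : ‖B (1 / n) ^ j‖ ≤ M := by
        rw [hpow]
        refine hM _ ⟨by positivity, ?_⟩
        have : (j : ℝ) ≤ n := by exact_mod_cast (by omega : j ≤ n)
        rw [mul_one_div]
        exact div_le_one_of_le₀ this (by positivity)
      have ha : ‖A (1 / n)‖ ≤ 1 := norm_toGL_le ρ _
      rw [e]
      calc _ ≤ ‖A (1 / n)‖ * ‖A (1 / n) ^ j - B (1 / n) ^ j‖
              + ‖A (1 / n) - B (1 / n)‖ * ‖B (1 / n) ^ j‖ :=
            (norm_add_le _ _).trans (add_le_add (norm_mul_le _ _) (norm_mul_le _ _))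
        _ ≤ 1 * (j * (M * ‖A (1 / n) - B (1 / n)‖)) + ‖A (1 / n) - B (1 / n)‖ * M := by
            gcongr
        _ = _ := by push_cast; ring
  have hd : HasDerivAt (fun t => A t - B t) 0 0 := (hc.sub hBd).congr_deriv (sub_self v)
  have h0 : A 0 - B 0 = 0 := by simp [hA, hB, hc0]
  have hlim : Filter.Tendsto (fun n : ℕ => (n : ℝ) * ‖A (1 / n) - B (1 / n)‖)
      Filter.atTop (𝓝 0) := by
    have h1 := hd.tendsto_slope_zero_right
    have h2 : Filter.Tendsto (fun n : ℕ => (1 / (n : ℝ))) Filter.atTop (𝓝[>] 0) := by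
      rw [tendsto_nhdsWithin_iff]
      refine ⟨tendsto_one_div_atTop_nhds_zero_nat, ?_⟩
      filter_upwards [Filter.eventually_gt_atTop 0] with n hn
      have : (0 : ℝ) < n := by exact_mod_cast hn
      simpa using this
    have h3 := (h1.comp h2).norm
    simp only [norm_zero] at h3
    refine h3.congr fun n => ?_
    simp [h0, norm_smul]
  have hlim2 : Filter.Tendsto (fun n : ℕ => A (1 / n) ^ n) Filter.atTop
      (𝓝 (NormedSpace.exp v)) := by
    rw [tendsto_iff_norm_sub_tendsto_zero]
    have hl := hlim.const_mul M
    rw [mul_zero] at hl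
    refine squeeze_zero' (Filter.Eventually.of_forall fun _ => norm_nonneg _) ?_ hl
    filter_upwards [Filter.eventually_gt_atTop 0] with n hn
    have := key n hn n le_rfl
    have hn' : (n : ℝ) ≠ 0 := by exact_mod_cast hn.ne'
    have e : B (1 / n) ^ n = NormedSpace.exp v := by
      rw [hpow, mul_one_div_cancel hn']; simp [hB]
    rw [e] at this
    linarith
  have := (isClosed_range_toGL ρ).mem_of_tendsto hlim2 (Filter.Eventually.of_forall fun n =>
    ⟨c (1 / n) ^ n, by simp [hA]⟩)
  exact this

/-- The Lie algebra `𝔨 = {s | exp (t s) ∈ ρ(K) for all real t}` of the compact group `ρ(K)`. -/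
def lieAlg [CompactSpace K] (ρ : K →ₜ* unitary (W →L[ℂ] W)) : Submodule ℝ (W →L[ℂ] W) where
  carrier := {s | ∀ t : ℝ, ∃ k : K, toGL ρ k = expUnit (t • s)}
  zero_mem' := fun t => ⟨1, by ext1; simp [expUnit]⟩
  smul_mem' := fun a s hs t => by
    obtain ⟨k, hk⟩ := hs (t * a)
    exact ⟨k, by rw [hk, mul_smul]⟩
  add_mem' := by
    intro a b ha hb t
    choose f hf using ha
    choose g hg using hb
    let c : ℝ → K := fun r => f (r * t) * g (r * t) * (f 0 * g 0)⁻¹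
    have h0 : toGL ρ (f 0 * g 0) = 1 := by
      rw [map_mul, hf, hg]; ext1; simp [expUnit]
    have hA : ∀ r, ((toGL ρ (c r) : (W →L[ℂ] W)ˣ) : W →L[ℂ] W)
        = NormedSpace.exp (r • (t • a)) * NormedSpace.exp (r • (t • b)) := by
      intro r
      simp only [c, map_mul, map_inv] at *
      rw [h0, hf, hg]
      simp [expUnit, mul_smul]
    have hd : HasDerivAt (fun r => ((toGL ρ (c r) : (W →L[ℂ] W)ˣ) : W →L[ℂ] W))
        (t • (a + b)) 0 := by
      have h1 := (hasDerivAt_exp_smul_const (𝕂 := ℝ) (t • a) (0 : ℝ)).mul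
        (hasDerivAt_exp_smul_const (𝕂 := ℝ) (t • b) (0 : ℝ))
      refine (h1.congr_of_eventuallyEq (Filter.Eventually.of_forall hA)).congr_deriv ?_
      simp
    obtain ⟨k, hk⟩ := exp_mem_range_of_hasDerivAt ρ c (t • (a + b)) (by simp [c]) hd
    exact ⟨k, by ext1; rw [hk]; rfl⟩

/-- The adjoint action `s ↦ k s k⁻¹` of `K` on its Lie algebra. -/
def adj [CompactSpace K] (ρ : K →ₜ* unitary (W →L[ℂ] W)) (k : K) (s : lieAlg ρ) : lieAlg ρ :=
  ⟨(toGL ρ k : W →L[ℂ] W) * (s : W →L[ℂ] W) * ((toGL ρ k)⁻¹ : (W →L[ℂ] W)ˣ), fun t => by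
    obtain ⟨l, hl⟩ := s.2 t
    refine ⟨k * l * k⁻¹, ?_⟩
    ext1
    rw [map_mul, map_mul, map_inv, hl, Units.val_mul, Units.val_mul]
    change _ = NormedSpace.exp _
    let _ : NormedAlgebra ℚ (W →L[ℂ] W) := NormedAlgebra.restrictScalars ℚ ℂ (W →L[ℂ] W)
    rw [← smul_mul_assoc, ← mul_smul_comm, NormedSpace.exp_units_conj]
    rfl⟩

variable [CompactSpace K] (ρ : K →ₜ* unitary (W →L[ℂ] W))

/-- The complexified Lie algebra `𝔤 = 𝔨 + i𝔨 ⊆ End(W)`; the sum is direct, because the elements of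
`𝔨` are skew-Hermitian. -/
def complexLieAlg : Submodule ℂ (W →L[ℂ] W) :=
  Submodule.span ℂ (lieAlg ρ : Set (W →L[ℂ] W))

/-- The inclusion `𝔨 ⊆ 𝔤`. -/
def incl (s : lieAlg ρ) : complexLieAlg ρ :=
  ⟨s, Submodule.subset_span s.2⟩

/-- The complexification `G = K^ℂ` of the compact group `K ≃ ρ(K) ⊆ U(W)`: the subgroup of `GL(W)`
generated by `ρ(K)` and `exp 𝔤`, where `𝔤 = 𝔨 ⊗ ℂ`. -/
def complexification : Subgroup (W →L[ℂ] W)ˣ :=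
  Subgroup.closure (Set.range (toGL ρ) ∪ expUnit '' (complexLieAlg ρ : Set (W →L[ℂ] W)))

/-- The inclusion `K → G`. -/
def toComplexification (k : K) : complexification ρ :=
  ⟨toGL ρ k, Subgroup.subset_closure (Or.inl ⟨k, rfl⟩)⟩

/-- The exponential map `𝔤 → G`. -/
def expG (ξ : complexLieAlg ρ) : complexification ρ :=
  ⟨expUnit ξ, Subgroup.subset_closure (Or.inr ⟨ξ, ξ.2, rfl⟩)⟩

end Group

/-! ### Kähler manifolds -/

section Kaehler

variable {E : Type*} [NormedAddCommGroup E] [NormedSpace ℂ E]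
  {F : Type*} [TopologicalSpace F] [ChartedSpace E F]

/-- The complex structure `I` on the (real) tangent spaces of a complex manifold modelled on `E`.
The tangent space at `x` is `E`, identified through the preferred chart at `x`. -/
def complexStructure (x : F) : TangentSpace 𝓘(ℝ, E) x →L[ℝ] TangentSpace 𝓘(ℝ, E) x :=
  (Complex.I • ContinuousLinearMap.id ℝ E : E →L[ℝ] E)

variable (E F) in
/-- A (not necessarily smooth) real 2-form on `F`. -/
abbrev TwoForm : Type _ := (x : F) → TangentSpace 𝓘(ℝ, E) x [⋀^Fin 2]→L[ℝ] ℝ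

/-- The expression of a 2-form in a chart `φ`, that is, its pull-back under `φ⁻¹`. -/
def TwoForm.inChart (Ω : TwoForm E F) (φ : OpenPartialHomeomorph F E) (u : E) :
    E [⋀^Fin 2]→L[ℝ] ℝ :=
  (Ω (φ.symm u)).compContinuousLinearMap (mfderiv 𝓘(ℝ, E) 𝓘(ℝ, E) φ.symm u)

/-- `Ω` is a Kähler form on the complex manifold `F`: a smooth closed real 2-form, invariant under
the complex structure `I`, for which `⟨u, v⟩ = Ω(u, I v)` is positive definite. -/
structure IsKaehlerForm (Ω : TwoForm E F) : Prop where
  smooth : ∀ φ ∈ atlas E F, ContDiffOn ℝ ∞ (Ω.inChart φ) φ.target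
  closed : ∀ φ ∈ atlas E F, ∀ u ∈ φ.target, extDeriv (Ω.inChart φ) u = 0
  invariant : ∀ (x : F) (v w : TangentSpace 𝓘(ℝ, E) x),
    Ω x ![complexStructure x v, complexStructure x w] = Ω x ![v, w]
  pos : ∀ (x : F) (v : TangentSpace 𝓘(ℝ, E) x), v ≠ 0 → 0 < Ω x ![v, complexStructure x v]

end Kaehler

/-! ### Hamiltonian actions, maximal weights, analytic stability -/

section Action

variable {W : Type*} [NormedAddCommGroup W] [InnerProductSpace ℂ W] [CompleteSpace W]
  {K : Type*} [Group K] [TopologicalSpace K] [CompactSpace K]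
  (ρ : K →ₜ* unitary (W →L[ℂ] W))
  {E : Type*} [NormedAddCommGroup E] [NormedSpace ℂ E]
  {F : Type*} [TopologicalSpace F] [ChartedSpace E F]
  [MulAction K F] [MulAction (complexification ρ) F]

variable (E F) in
/-- The action of `K` on the complex manifold `F` extends to the given holomorphic action of the
complex Lie group `G = K^ℂ`. Holomorphy of `G × F → F` is expressed in the exponential charts
`ξ ↦ g exp ξ` of `G`, which amounts to `mdiff_smul` and `mdiff_exp`. -/
structure IsHolomorphicExtension : Prop where
  extends_action : ∀ (k : K) (x : F), toComplexification ρ k • x = k • x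
  continuous_smul : Continuous fun p : complexification ρ × F => p.1 • p.2
  mdiff_smul : ∀ g : complexification ρ, ContMDiff 𝓘(ℂ, E) 𝓘(ℂ, E) ω fun x : F => g • x
  mdiff_exp : ContMDiff (𝓘(ℂ, complexLieAlg ρ).prod 𝓘(ℂ, E)) 𝓘(ℂ, E) ω
    fun p : complexLieAlg ρ × F => expG ρ p.1 • p.2

variable (E) in
/-- The vector field `X_s` on `F` generated by `s ∈ 𝔨`: `X_s(x) = d/dt exp(ts) x` at `t = 0`. -/
def fundamentalField (s : lieAlg ρ) (x : F) : TangentSpace 𝓘(ℝ, E) x :=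
  mfderiv 𝓘(ℝ, ℝ) 𝓘(ℝ, E) (fun t : ℝ => expG ρ ((t : ℂ) • incl ρ s) • x) 0 (1 : ℝ)

variable (K) in
/-- `K` preserves the 2-form `Ω`. -/
def PreservesForm (Ω : TwoForm E F) : Prop :=
  ∀ (k : K) (x : F) (v w : TangentSpace 𝓘(ℝ, E) x),
    Ω (k • x) ![mfderiv 𝓘(ℝ, E) 𝓘(ℝ, E) (fun y : F => k • y) x v,
      mfderiv 𝓘(ℝ, E) 𝓘(ℝ, E) (fun y : F => k • y) x w] = Ω x ![v, w]

/-- `μ : F → 𝔨*` is a moment map for the action of `K` on `(F, Ω)`: it is smooth, the function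
`μ_s = ⟨μ, s⟩` satisfies `dμ_s = Ω(X_s, ·)` for all `s ∈ 𝔨`, and `μ` is equivariant for the
coadjoint action, that is, `⟨μ(kx), k s k⁻¹⟩ = ⟨μ(x), s⟩`. -/
structure IsMomentMap (Ω : TwoForm E F) (μ : F → Module.Dual ℝ (lieAlg ρ)) : Prop where
  smooth : ∀ s : lieAlg ρ, ContMDiff 𝓘(ℝ, E) 𝓘(ℝ, ℝ) ∞ fun x : F => μ x s
  hamiltonian : ∀ (s : lieAlg ρ) (x : F) (v : TangentSpace 𝓘(ℝ, E) x),
    mfderiv 𝓘(ℝ, E) 𝓘(ℝ, ℝ) (fun y : F => μ y s) x v = Ω x ![fundamentalField ρ E s x, v]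
  equivariant : ∀ (k : K) (x : F) (s : lieAlg ρ), μ (k • x) (adj ρ k s) = μ x s

variable {ρ}

/-- `λ_t(x; s) = ⟨μ(exp(its) x), s⟩`. -/
def weightAt (μ : F → Module.Dual ℝ (lieAlg ρ)) (x : F) (s : lieAlg ρ) (t : ℝ) : ℝ :=
  μ (expG ρ ((t * Complex.I : ℂ) • incl ρ s) • x) s

/-- The maximal weight `λ(x; s) = lim_{t → ∞} λ_t(x; s)`, an extended real number. -/
def maximalWeight (μ : F → Module.Dual ℝ (lieAlg ρ)) (x : F) (s : lieAlg ρ) : EReal :=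
  Filter.limUnder Filter.atTop fun t : ℝ => (weightAt μ x s t : EReal)

/-- `x` is analytically stable: `λ(x; s) > 0` for every nonzero `s ∈ 𝔨`. -/
def AnalyticallyStable (μ : F → Module.Dual ℝ (lieAlg ρ)) (x : F) : Prop :=
  ∀ s : lieAlg ρ, s ≠ 0 → 0 < maximalWeight μ x s

/-- The set of `K`-orbits contained in the orbit `G x` on which the moment map vanishes. -/
def zeroOrbits (μ : F → Module.Dual ℝ (lieAlg ρ)) (x : F) : Set (Set F) :=
  {O | (∃ y : F, O = MulAction.orbit K y) ∧ O ⊆ MulAction.orbit (complexification ρ) x ∧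
    ∀ z ∈ O, μ z = 0}

end Action

end KempfNess

end

/-!
Write `λ_t(x; s) = ⟨μ(exp(its) x), s⟩`. The curve `t ↦ exp(its) x` has velocity `I X_s`, so `λ_t`
has derivative `Ω(X_s, I X_s) ≥ 0` along it (`dmoment_inclI_nonneg`). Hence `λ_t` is monotone, the
maximal weight exists and is positive if and only if some `λ_t` is; and if `λ_t` agrees at two
times, then `X_s = 0` on the curve and the complex one-parameter group of `s` fixes it
(`smul_eq_of_moment_eq_zero`).

The geometry of `G` enters through the polar decomposition `G = K exp(i𝔨)` (`exists_polar`). The set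
`K exp(i𝔨)` is closed, and every left-invariant vector field `g ↦ g ξ`, `ξ ∈ 𝔤`, is tangent to it,
because the differential of `(k, σ) ↦ k exp(iσ)` is onto (`imBeta_surjective`). By an inequality of
Gronwall type for the distance to the set, it is stable under right multiplication by `exp ξ`, so it
is all of `G`.

*Uniqueness.* Let `μ` vanish at `y` and at `g y`, with `g = k exp(iσ)`. Then `λ_t(y; σ)` vanishes at
`t = 0` and `t = 1`, so `exp(iσ)` fixes `y` and `g y = k y` (`orbit_eq_of_moment_eq_zero`).

*Existence.* The Kempf–Ness function `Ψ` of `x` lives on `K \ G`, with coordinates `σ ↦ K exp(iσ)`;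
it is the integral of `μ` along the geodesic `exp(iuσ)`, `0 ≤ u ≤ 1`. The one-form it integrates is
closed, by the equivariance of `μ` and the symmetry of `(s, r) ↦ Ω(X_s, I X_r)`, so that `Ψ` has
derivative `λ_t(h x; s)` along every curve `exp(its) h` (`hasFDerivAt_kempfNess`,
`exists_kempfNess_curve`). If `x` is stable, then `Ψ` grows at least linearly
(`exists_kempfNess_lower_bound`), so it has a minimum `exp(iσ)`, and `μ` vanishes at `exp(iσ) x`.

*Stability is constant on `G`-orbits* (`AnalyticallyStable.smul`). If `x` is stable and
`λ_t(h x; s) ≤ 0` for all `t`, then `Ψ` is bounded above along `exp(its) h` for `t ≥ 0`. By its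
growth the elements `exp(its)` and their inverses stay bounded, and `z ↦ exp(zs)` is a bounded
entire function, so `s = 0`.

*Stabilizers.* By the previous point both directions can be proved at a zero `y` of `μ`. If `y` is
stable, no one-parameter group of `𝔨` fixes `y`, since its weight would vanish identically. By the
uniqueness argument the stabilizer of `y` then lies in `K`, and a compact group without
one-parameter subgroups is finite (`finite_stabilizer_of_moment_eq_zero`). Conversely, let the
stabilizer of `y` be finite. Since `λ_0(y; s) = 0`, the weight `λ_1(y; s)` is positive unless the
one-parameter group of `s` fixes `y`, which forces `s = 0` (`analyticallyStable_of_moment_eq_zero`).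
-/

open scoped Manifold ContDiff Topology

set_option linter.unusedSectionVars false

noncomputable section

namespace KempfNess

/-! ### The exponential map of `End(W)` -/

section Duhamel

variable {V V' : Type*} [NormedAddCommGroup V] [NormedSpace ℝ V] [NormedAddCommGroup V']
  [NormedSpace ℝ V'] [CompleteSpace V']

/-- The formula of Duhamel for the derivative of the exponential map, in an abstract form. The
function `N (a, b, c)` plays the role of `exp a * exp b * exp c`, or of a function of such a product
acting on a point; the hypotheses `h₁` and `h₂` say that exponentials of multiples of one vector in
adjacent slots multiply. The proof differentiates `u ↦ N ((1 - u) ξ, 0, u (ξ + τ η))`, which runs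
from `N (0, 0, ξ)` to `N (0, 0, ξ + τ η)`. -/
theorem fderiv_eq_integral_duhamel {N : V × V × V → V'} (hN : ContDiff ℝ 1 N)
    (h₁ : ∀ (a c : V) (r e : ℝ), N ((r + e) • a, 0, c) = N (r • a, e • a, c))
    (h₂ : ∀ (a c : V) (r e : ℝ), N (a, 0, (r + e) • c) = N (a, e • c, r • c)) (ξ η : V) :
    fderiv ℝ (fun c => N (0, 0, c)) ξ η =
      ∫ u in (0 : ℝ)..1, fderiv ℝ (fun b => N ((1 - u) • ξ, b, u • ξ)) 0 η := by
  have hd : Differentiable ℝ N := hN.differentiable one_ne_zero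
  -- the derivative of `N` in the middle variable
  have hmid : ∀ p : V × V × V, ∀ η : V, fderiv ℝ (fun b => N (p.1, b, p.2.2)) 0 η
      = fderiv ℝ N (p.1, 0, p.2.2) (0, η, 0) := by
    intro p η
    have h : HasFDerivAt (fun b : V => (p.1, b, p.2.2))
        ((0 : V →L[ℝ] V).prod ((ContinuousLinearMap.id ℝ V).prod (0 : V →L[ℝ] V))) 0 :=
      (hasFDerivAt_const p.1 (0 : V)).prodMk
        ((hasFDerivAt_id (0 : V)).prodMk (hasFDerivAt_const p.2.2 (0 : V)))
    have h2 := ((hd (p.1, 0, p.2.2)).hasFDerivAt.comp (0 : V) h).fderiv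
    have h3 : (fun b => N (p.1, b, p.2.2)) = N ∘ fun b => (p.1, b, p.2.2) := rfl
    rw [h3, h2]; simp
  -- both outer derivatives along `a`, `c` agree with the middle one
  have hout : ∀ (a c : V) (r : ℝ), fderiv ℝ N (r • a, 0, c) (a, 0, 0)
      = fderiv ℝ N (r • a, 0, c) (0, a, 0) := by
    intro a c r
    have e1 : HasDerivAt (fun e : ℝ => ((r + e) • a, (0 : V), c)) (a, 0, 0) 0 := by
      refine HasDerivAt.prodMk ?_ (HasDerivAt.prodMk (hasDerivAt_const _ _) (hasDerivAt_const _ _))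
      simpa using ((hasDerivAt_id (0 : ℝ)).const_add r).smul_const a
    have e2 : HasDerivAt (fun e : ℝ => (r • a, e • a, c)) (0, a, 0) 0 := by
      refine HasDerivAt.prodMk (hasDerivAt_const _ _) (HasDerivAt.prodMk ?_ (hasDerivAt_const _ _))
      simpa using (hasDerivAt_id (0 : ℝ)).smul_const a
    have f1 := (hd ((r + 0) • a, 0, c)).hasFDerivAt.comp_hasDerivAt (0 : ℝ) e1
    have f2 := (hd (r • a, (0 : ℝ) • a, c)).hasFDerivAt.comp_hasDerivAt (0 : ℝ) e2
    simp only [add_zero, zero_smul] at f1 f2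
    refine f1.unique (f2.congr_of_eventuallyEq (Filter.Eventually.of_forall fun e => ?_))
    simpa using h₁ a c r e
  have hout' : ∀ (a c : V) (r : ℝ), fderiv ℝ N (a, 0, r • c) (0, 0, c)
      = fderiv ℝ N (a, 0, r • c) (0, c, 0) := by
    intro a c r
    have e1 : HasDerivAt (fun e : ℝ => (a, (0 : V), (r + e) • c)) (0, 0, c) 0 := by
      refine HasDerivAt.prodMk (hasDerivAt_const _ _) (HasDerivAt.prodMk (hasDerivAt_const _ _) ?_)
      simpa using ((hasDerivAt_id (0 : ℝ)).const_add r).smul_const c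
    have e2 : HasDerivAt (fun e : ℝ => (a, e • c, r • c)) (0, c, 0) 0 := by
      refine HasDerivAt.prodMk (hasDerivAt_const _ _) (HasDerivAt.prodMk ?_ (hasDerivAt_const _ _))
      simpa using (hasDerivAt_id (0 : ℝ)).smul_const c
    have f1 := (hd (a, 0, (r + 0) • c)).hasFDerivAt.comp_hasDerivAt (0 : ℝ) e1
    have f2 := (hd (a, (0 : ℝ) • c, r • c)).hasFDerivAt.comp_hasDerivAt (0 : ℝ) e2
    simp only [add_zero, zero_smul] at f1 f2
    refine f1.unique (f2.congr_of_eventuallyEq (Filter.Eventually.of_forall fun e => ?_))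
    simpa using h₂ a c r e
  let I : ℝ → ℝ → V' := fun τ u => fderiv ℝ N ((1 - u) • ξ, 0, u • (ξ + τ • η)) (0, η, 0)
  have hIc : Continuous (Function.uncurry I) := by
    have := hN.continuous_fderiv one_ne_zero
    simp only [I, Function.uncurry_def]
    fun_prop
  have key : ∀ τ : ℝ, N (0, 0, ξ + τ • η) - N (0, 0, ξ) = τ • ∫ u in (0 : ℝ)..1, I τ u := by
    intro τ
    set ζ := ξ + τ • η with hζ
    have hderiv : ∀ u : ℝ, HasDerivAt (fun u : ℝ => N ((1 - u) • ξ, 0, u • ζ)) (τ • I τ u) u := by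
      intro u
      have e1 : HasDerivAt (fun u : ℝ => ((1 - u) • ξ, (0 : V), u • ζ)) (-ξ, 0, ζ) u := by
        refine HasDerivAt.prodMk ?_ (HasDerivAt.prodMk (hasDerivAt_const _ _) ?_)
        · simpa using ((hasDerivAt_id u).const_sub 1).smul_const ξ
        · simpa using (hasDerivAt_id u).smul_const ζ
      have f1 := (hd ((1 - u) • ξ, 0, u • ζ)).hasFDerivAt.comp_hasDerivAt u e1
      refine f1.congr_deriv ?_
      have e2 : ((-ξ, 0, ζ) : V × V × V) = -(ξ, 0, 0) + (0, 0, ζ) := by simp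
      rw [e2, map_add, map_neg, hout, hout', ← map_neg, ← map_add]
      simp only [I, ← map_smul]
      congr 1
      simp [hζ]
    have hint := intervalIntegral.integral_eq_sub_of_hasDerivAt (a := (0 : ℝ)) (b := 1)
      (fun u _ => hderiv u) ((by fun_prop : Continuous fun u => τ • I τ u).intervalIntegrable _ _)
    rw [intervalIntegral.integral_smul] at hint
    rw [hint]
    have a1 : N (ξ, 0, 0) = N (0, 0, ξ) := by
      have := h₁ ξ 0 0 1
      have h' := h₂ 0 ξ 0 1
      simp at this h'
      rw [this, h']
    simp [a1]
  have hI0 : Continuous fun τ => ∫ u in (0 : ℝ)..1, I τ u :=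
    intervalIntegral.continuous_parametric_intervalIntegral_of_continuous' hIc 0 1
  have hA : HasDerivAt (fun τ : ℝ => N (0, 0, ξ + τ • η))
      (fderiv ℝ (fun c => N (0, 0, c)) ξ η) 0 := by
    have hdc : Differentiable ℝ fun c => N (0, 0, c) := by fun_prop
    have e1 : HasDerivAt (fun τ : ℝ => ξ + τ • η) η 0 := by
      simpa using ((hasDerivAt_id (0 : ℝ)).smul_const η).const_add ξ
    have := (hdc (ξ + (0 : ℝ) • η)).hasFDerivAt.comp_hasDerivAt (0 : ℝ) e1
    simpa [Function.comp_def] using this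
  have hB : HasDerivAt (fun τ : ℝ => N (0, 0, ξ + τ • η)) (∫ u in (0 : ℝ)..1, I 0 u) 0 := by
    rw [hasDerivAt_iff_tendsto_slope_zero]
    have := (hI0.tendsto 0).mono_left (nhdsWithin_le_nhds (s := {0}ᶜ))
    refine this.congr' ?_
    filter_upwards [self_mem_nhdsWithin] with τ hτ
    simp only [zero_add, zero_smul, add_zero]
    rw [key, inv_smul_smul₀ hτ]
  rw [hA.unique hB]
  refine intervalIntegral.integral_congr fun u _ => ?_
  simp only [I, zero_smul, add_zero]
  exact (hmid ((1 - u) • ξ, 0, u • ξ) η).symm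

end Duhamel

section Exp

variable {W : Type*} [NormedAddCommGroup W] [InnerProductSpace ℂ W] [CompleteSpace W]

theorem exp_add_eq_mul_of_commute {a b : W →L[ℂ] W} (h : Commute a b) :
    NormedSpace.exp (a + b) = NormedSpace.exp a * NormedSpace.exp b := by
  let _ : NormedAlgebra ℚ (W →L[ℂ] W) := NormedAlgebra.restrictScalars ℚ ℂ (W →L[ℂ] W)
  exact NormedSpace.exp_add_of_commute h

theorem exp_mul_exp_neg (a : W →L[ℂ] W) : NormedSpace.exp a * NormedSpace.exp (-a) = 1 :=
  (expUnit a).val_inv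

theorem exp_neg_mul_exp (a : W →L[ℂ] W) : NormedSpace.exp (-a) * NormedSpace.exp a = 1 :=
  (expUnit a).inv_val

theorem contDiff_exp : ContDiff ℝ 1 (NormedSpace.exp : (W →L[ℂ] W) → W →L[ℂ] W) :=
  contDiff_iff_contDiffAt.2 fun x => (NormedSpace.exp_analytic (𝕂 := ℝ) x).contDiffAt

theorem differentiable_exp : Differentiable ℝ (NormedSpace.exp : (W →L[ℂ] W) → W →L[ℂ] W) :=
  contDiff_exp.differentiable one_ne_zero

theorem fderiv_exp_eq_integral (p q : W →L[ℂ] W) :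
    fderiv ℝ NormedSpace.exp p q = ∫ u in (0 : ℝ)..1,
      NormedSpace.exp ((1 - u) • p) * q * NormedSpace.exp (u • p) := by
  have hadd : ∀ (a : W →L[ℂ] W) (r e : ℝ), NormedSpace.exp ((r + e) • a)
      = NormedSpace.exp (r • a) * NormedSpace.exp (e • a) := by
    intro a r e
    rw [add_smul, exp_add_eq_mul_of_commute (((Commute.refl a).smul_left r).smul_right e)]
  have h := fderiv_eq_integral_duhamel (N := fun x : (W →L[ℂ] W) × (W →L[ℂ] W) × (W →L[ℂ] W) =>
    NormedSpace.exp x.1 * NormedSpace.exp x.2.1 * NormedSpace.exp x.2.2)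
    (by
      have := contDiff_exp (W := W)
      fun_prop)
    (fun a c r e => by simp [hadd]) (fun a c r e => by
      rw [add_comm r e]; simp [hadd, mul_assoc]) p q
  simp only [NormedSpace.exp_zero, one_mul] at h
  rw [h]
  refine intervalIntegral.integral_congr fun u _ => ?_
  have h0 : HasFDerivAt NormedSpace.exp (1 : (W →L[ℂ] W) →L[ℝ] (W →L[ℂ] W)) 0 :=
    hasFDerivAt_exp_zero
  have h1 := (ContinuousLinearMap.mulLeftRight ℝ (W →L[ℂ] W) (NormedSpace.exp ((1 - u) • p))
    (NormedSpace.exp (u • p))).hasFDerivAt.comp (0 : W →L[ℂ] W) h0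
  have h2 := h1.fderiv
  simp only [Function.comp_def, ContinuousLinearMap.mulLeftRight_apply] at h2
  simp [h2]

/-- The exponential map is an immersion at Hermitian operators: a direction `q` in the kernel of its
differential at `p` commutes with `exp p`, hence with `p`, and then the derivative in the direction
`q` is `exp p * q`. -/
theorem fderiv_exp_injective {p : W →L[ℂ] W} (hp : IsSelfAdjoint p) :
    Function.Injective (fderiv ℝ NormedSpace.exp p) := by
  rw [injective_iff_map_eq_zero]
  intro q hq
  have hc : HasDerivAt (fun t : ℝ => p + t • q) q 0 := by
    simpa using ((hasDerivAt_id (0 : ℝ)).smul_const q).const_add p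
  have he : HasDerivAt (fun t : ℝ => NormedSpace.exp (p + t • q)) 0 0 := by
    have := (differentiable_exp (p + (0 : ℝ) • q)).hasFDerivAt.comp_hasDerivAt (0 : ℝ) hc
    simpa [hq, Function.comp_def] using this
  have hcomm : Commute (NormedSpace.exp p) q := by
    -- differentiate the relation that `p + t q` commutes with its exponential
    have h1 := hc.mul he
    have h2 := he.mul hc
    have h4 := h1.unique (h2.congr_of_eventuallyEq (Filter.Eventually.of_forall fun t =>
      (Commute.refl (p + t • q)).exp_right.eq))
    simp at h4
    exact h4.symm
  have hcomm' : Commute p q := by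
    have := hcomm.cfc_real Real.log
    rwa [← CFC.log, CFC.log_exp p hp] at this
  have he' : HasDerivAt (fun t : ℝ => NormedSpace.exp (p + t • q)) (NormedSpace.exp p * q) 0 := by
    have h5 := (hasDerivAt_exp_smul_const (𝕂 := ℝ) q (0 : ℝ)).const_mul (NormedSpace.exp p)
    simp only [zero_smul, NormedSpace.exp_zero, one_mul] at h5
    refine h5.congr_of_eventuallyEq (Filter.Eventually.of_forall fun t => ?_)
    exact exp_add_eq_mul_of_commute (hcomm'.smul_right t)
  have h6 := he'.unique he
  calc q = NormedSpace.exp (-p) * (NormedSpace.exp p * q) := by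
        rw [← mul_assoc, exp_neg_mul_exp, one_mul]
    _ = 0 := by rw [h6, mul_zero]

theorem exp_injOn_isSelfAdjoint {p q : W →L[ℂ] W} (hp : IsSelfAdjoint p) (hq : IsSelfAdjoint q)
    (h : NormedSpace.exp p = NormedSpace.exp q) : p = q := by
  rw [← CFC.log_exp p hp, h, CFC.log_exp q hq]

theorem isSelfAdjoint_real_smul {p : W →L[ℂ] W} (hp : IsSelfAdjoint p) (t : ℝ) :
    IsSelfAdjoint (t • p) := by
  rw [IsSelfAdjoint, star_smul, hp.star_eq, star_trivial]

theorem isSelfAdjoint_fderiv_exp {p q : W →L[ℂ] W} (hp : IsSelfAdjoint p) (hq : IsSelfAdjoint q) :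
    IsSelfAdjoint (fderiv ℝ NormedSpace.exp p q) := by
  have hc : HasDerivAt (fun t : ℝ => p + t • q) q 0 := by
    simpa using ((hasDerivAt_id (0 : ℝ)).smul_const q).const_add p
  have h1 := (differentiable_exp (p + (0 : ℝ) • q)).hasFDerivAt.comp_hasDerivAt (0 : ℝ) hc
  have h2 := h1.star
  have h3 := h2.congr_of_eventuallyEq (f₁ := NormedSpace.exp ∘ fun t : ℝ => p + t • q)
    (Filter.Eventually.of_forall fun t => by
      simp only [Function.comp_apply]
      rw [NormedSpace.star_exp, (hp.add (isSelfAdjoint_real_smul hq t)).star_eq])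
  have h4 := h3.unique h1
  simp only [zero_smul, add_zero] at h4
  exact h4

theorem exp_mul_exp_self (p : W →L[ℂ] W) :
    NormedSpace.exp p * NormedSpace.exp p = NormedSpace.exp ((2 : ℝ) • p) := by
  rw [two_smul, exp_add_eq_mul_of_commute (Commute.refl p)]

/-- The logarithm of a differentiable curve of positive operators is differentiable. -/
theorem hasDerivAt_of_exp [FiniteDimensional ℂ W] {p h : ℝ → W →L[ℂ] W} {h' : W →L[ℂ] W} {t : ℝ}
    (hp : ∀ t, IsSelfAdjoint (p t)) (he : ∀ t, NormedSpace.exp (p t) = h t)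
    (hh : HasDerivAt h h' t) (hc : Continuous h) :
    ∃ p' : W →L[ℂ] W, HasDerivAt p p' t ∧ fderiv ℝ NormedSpace.exp (p t) p' = h' := by
  have hpc : ContinuousAt p t := by
    have h1 : p = fun t => CFC.log (h t) := by
      ext1 t; rw [← he, CFC.log_exp _ (hp t)]
    rw [h1]
    refine Continuous.continuousAt ?_
    refine CFC.continuousOn_log.comp_continuous hc fun t => ?_
    rw [← he]
    exact ⟨by rw [IsSelfAdjoint, NormedSpace.star_exp, (hp t).star_eq], (expUnit (p t)).isUnit⟩
  have hD : HasStrictFDerivAt NormedSpace.exp (fderiv ℝ NormedSpace.exp (p t)) (p t) :=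
    contDiff_exp.contDiffAt.hasStrictFDerivAt one_ne_zero
  let e : (W →L[ℂ] W) ≃L[ℝ] (W →L[ℂ] W) := (LinearEquiv.ofInjectiveEndo
    (fderiv ℝ NormedSpace.exp (p t) : (W →L[ℂ] W) →ₗ[ℝ] (W →L[ℂ] W))
    (fderiv_exp_injective (hp t))).toContinuousLinearEquiv
  have hee : (e : (W →L[ℂ] W) →L[ℝ] (W →L[ℂ] W)) = fderiv ℝ NormedSpace.exp (p t) := by
    ext1 x; rfl
  rw [← hee] at hD
  have hl := hD.to_localInverse.hasFDerivAt
  rw [he t] at hl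
  have hl2 := hl.comp_hasDerivAt t hh
  refine ⟨e.symm h', hl2.congr_of_eventuallyEq ?_, ?_⟩
  · filter_upwards [hpc.eventually hD.eventually_left_inverse] with x hx
    simp only [Function.comp_apply]
    rw [← he x, hx]
  · rw [← hee]; simp

end Exp

/-! ### The Lie algebras `𝔨` and `𝔤 = 𝔨 ⊕ i𝔨` -/

section LieAlgebra

variable {W : Type*} [NormedAddCommGroup W] [InnerProductSpace ℂ W] [CompleteSpace W]
  {K : Type*} [Group K] [TopologicalSpace K] [CompactSpace K] {ρ : K →ₜ* unitary (W →L[ℂ] W)}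

theorem star_toGL_mul {K : Type*} [Group K] [TopologicalSpace K]
    {ρ : K →ₜ* unitary (W →L[ℂ] W)} (k : K) :
    star ((toGL ρ k : (W →L[ℂ] W)ˣ) : W →L[ℂ] W) * (toGL ρ k : (W →L[ℂ] W)ˣ) = 1 :=
  (Unitary.mem_iff.1 (ρ k).2).1

theorem exists_toGL_eq_exp (s : lieAlg ρ) :
    ∃ k : K, ((toGL ρ k : (W →L[ℂ] W)ˣ) : W →L[ℂ] W) = NormedSpace.exp (s : W →L[ℂ] W) := by
  obtain ⟨k, hk⟩ := s.2 1
  exact ⟨k, by rw [hk]; simp [expUnit]⟩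

/-- The elements of `𝔨` are skew-Hermitian, since `ρ(K)` is unitary. -/
theorem star_lieAlg (s : lieAlg ρ) : star (s : W →L[ℂ] W) = -s := by
  have h1 := ((hasDerivAt_exp_smul_const (𝕂 := ℝ) (star (s : W →L[ℂ] W)) (0 : ℝ)).mul
    (hasDerivAt_exp_smul_const (𝕂 := ℝ) (s : W →L[ℂ] W) (0 : ℝ)))
  have h2 : ∀ t : ℝ, NormedSpace.exp (t • star (s : W →L[ℂ] W)) *
      NormedSpace.exp (t • (s : W →L[ℂ] W)) = 1 := by
    intro t
    obtain ⟨k, hk⟩ := exists_toGL_eq_exp (t • s)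
    have := star_toGL_mul (ρ := ρ) k
    rw [hk, NormedSpace.star_exp] at this
    simpa using this
  have h3 := (h1.congr_of_eventuallyEq (Filter.Eventually.of_forall fun t => (h2 t).symm)).unique
    (hasDerivAt_const (0 : ℝ) (1 : W →L[ℂ] W))
  simp at h3
  exact eq_neg_of_add_eq_zero_left h3

theorem isSelfAdjoint_I_smul (s : lieAlg ρ) :
    IsSelfAdjoint (Complex.I • (s : W →L[ℂ] W)) := by
  rw [IsSelfAdjoint, star_smul, star_lieAlg]
  simp

variable (ρ) in
/-- The inclusion `𝔨 ⊆ 𝔤` as a real-linear map. -/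
def inclₗ : lieAlg ρ →ₗ[ℝ] complexLieAlg ρ where
  toFun := incl ρ
  map_add' _ _ := rfl
  map_smul' _ _ := rfl

variable (ρ) in
/-- The map `s ↦ i s` from `𝔨` to `𝔤`. -/
def inclI : lieAlg ρ →ₗ[ℝ] complexLieAlg ρ where
  toFun s := Complex.I • incl ρ s
  map_add' a b := smul_add Complex.I (incl ρ a) (incl ρ b)
  map_smul' a b := smul_comm Complex.I a (incl ρ b)

@[simp] theorem coe_incl (s : lieAlg ρ) : (incl ρ s : W →L[ℂ] W) = s := rfl

@[simp] theorem coe_inclₗ (s : lieAlg ρ) : (inclₗ ρ s : W →L[ℂ] W) = s := rfl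

@[simp] theorem coe_inclI (s : lieAlg ρ) : (inclI ρ s : W →L[ℂ] W) = Complex.I • (s : W →L[ℂ] W) :=
  rfl

theorem isSelfAdjoint_inclI (s : lieAlg ρ) : IsSelfAdjoint (inclI ρ s : W →L[ℂ] W) :=
  isSelfAdjoint_I_smul s

theorem coe_real_smul (a : ℝ) (b : complexLieAlg ρ) :
    ((a • b : complexLieAlg ρ) : W →L[ℂ] W) = a • (b : W →L[ℂ] W) := rfl

/-- The skew-Hermitian part of an element of `𝔤` lies in `𝔨`, and its Hermitian part lies in `i𝔨`.
-/
theorem re_im_mem {b : W →L[ℂ] W} (hb : b ∈ complexLieAlg ρ) :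
    (1 / 2 : ℝ) • (b - star b) ∈ lieAlg ρ ∧
      (1 / 2 : ℝ) • (-Complex.I • (b + star b)) ∈ lieAlg ρ := by
  induction hb using Submodule.span_induction with
  | mem x h =>
    have h1 : star x = -x := star_lieAlg (ρ := ρ) ⟨x, h⟩
    rw [h1, sub_neg_eq_add, add_neg_cancel, smul_zero, smul_zero, ← two_smul ℝ x, smul_smul]
    norm_num
    exact h
  | zero => simp
  | add x y _ _ hx hy =>
    constructor
    · convert add_mem hx.1 hy.1 using 1
      rw [star_add]; module
    · convert add_mem hx.2 hy.2 using 1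
      rw [star_add, ← smul_add, ← smul_add]; congr 2; abel
  | smul z x _ hx =>
    have hz : z • x = z.re • x + z.im • (Complex.I • x) := by
      conv_lhs => rw [← Complex.re_add_im z]
      rw [add_smul, mul_smul]; rfl
    have hz' : star (z • x) = z.re • star x - z.im • (Complex.I • star x) := by
      rw [hz, star_add, star_smul, star_smul, star_smul]; simp [sub_eq_add_neg]
    have hII : ∀ y : W →L[ℂ] W, Complex.I • Complex.I • y = -y := by
      intro y; rw [smul_smul, Complex.I_mul_I, neg_one_smul]
    constructor
    · convert sub_mem ((lieAlg ρ).smul_mem z.re hx.1) ((lieAlg ρ).smul_mem z.im hx.2) using 1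
      rw [hz', hz, neg_smul, smul_add]; module
    · convert add_mem ((lieAlg ρ).smul_mem z.re hx.2) ((lieAlg ρ).smul_mem z.im hx.1) using 1
      rw [hz', hz]
      simp only [neg_smul, smul_add, smul_sub, smul_comm Complex.I (_ : ℝ), hII]
      module

variable (ρ) in
/-- The component in `𝔨` of an element of `𝔤 = 𝔨 ⊕ i𝔨`: its skew-Hermitian part. -/
def reP : complexLieAlg ρ →ₗ[ℝ] lieAlg ρ where
  toFun b := ⟨_, (re_im_mem b.2).1⟩
  map_add' a b := by ext1; simp only [Submodule.coe_add, star_add]; module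
  map_smul' r b := by
    ext1
    change (1 / 2 : ℝ) • (r • (b : W →L[ℂ] W) - star (r • (b : W →L[ℂ] W))) = r • _
    rw [star_smul, star_trivial]; module

variable (ρ) in
/-- The element `b ∈ 𝔨` in the decomposition `a + ib` of an element of `𝔤 = 𝔨 ⊕ i𝔨`. -/
def imP : complexLieAlg ρ →ₗ[ℝ] lieAlg ρ where
  toFun b := ⟨_, (re_im_mem b.2).2⟩
  map_add' a b := by ext1; simp only [Submodule.coe_add, star_add]; module
  map_smul' r b := by
    ext1
    change (1 / 2 : ℝ) • (-Complex.I • (r • (b : W →L[ℂ] W) + star (r • (b : W →L[ℂ] W)))) = r • _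
    rw [star_smul, star_trivial, ← smul_add, smul_comm _ r, smul_comm _ r]

theorem coe_imP (b : complexLieAlg ρ) : (imP ρ b : W →L[ℂ] W) =
    (1 / 2 : ℝ) • (-Complex.I • ((b : W →L[ℂ] W) + star (b : W →L[ℂ] W))) := rfl

theorem coe_reP (b : complexLieAlg ρ) : (reP ρ b : W →L[ℂ] W) =
    (1 / 2 : ℝ) • ((b : W →L[ℂ] W) - star (b : W →L[ℂ] W)) := rfl

theorem reP_add_imP (b : complexLieAlg ρ) : inclₗ ρ (reP ρ b) + inclI ρ (imP ρ b) = b := by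
  ext1
  simp only [Submodule.coe_add, coe_inclₗ, coe_inclI, coe_imP, coe_reP, neg_smul, smul_neg]
  rw [smul_comm Complex.I, smul_smul Complex.I, Complex.I_mul_I]
  module

@[simp] theorem imP_inclₗ (s : lieAlg ρ) : imP ρ (inclₗ ρ s) = 0 := by
  ext1; rw [coe_imP, coe_inclₗ, star_lieAlg]; simp

@[simp] theorem imP_inclI (s : lieAlg ρ) : imP ρ (inclI ρ s) = s := by
  ext1
  rw [coe_imP, (show star (inclI ρ s : W →L[ℂ] W) = inclI ρ s from isSelfAdjoint_I_smul s),
    coe_inclI, ← two_smul ℝ, smul_comm _ (2 : ℝ), smul_smul, neg_smul, smul_smul, Complex.I_mul_I]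
  norm_num

theorem add_star_eq (b : complexLieAlg ρ) : (b : W →L[ℂ] W) + star (b : W →L[ℂ] W) =
    (2 : ℝ) • (inclI ρ (imP ρ b) : W →L[ℂ] W) := by
  rw [coe_inclI, coe_imP, neg_smul, smul_neg, smul_neg, smul_comm Complex.I, smul_smul Complex.I,
    Complex.I_mul_I]
  module

theorem coe_eq_of_imP_eq_zero {b : complexLieAlg ρ} (h : imP ρ b = 0) :
    (b : W →L[ℂ] W) = reP ρ b := by
  conv_lhs => rw [← reP_add_imP b, h, map_zero, add_zero]
  rfl

/-- `𝔤` is stable under conjugation by the complex one-parameter groups of `𝔨`: for real parameters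
this holds because `K` normalizes `𝔨`, and the general case follows by the identity theorem. -/
theorem conj_exp_mem [FiniteDimensional ℂ W] (s : lieAlg ρ) (z : ℂ) {b : W →L[ℂ] W}
    (hb : b ∈ complexLieAlg ρ) :
    NormedSpace.exp (z • (s : W →L[ℂ] W)) * b * NormedSpace.exp (-(z • (s : W →L[ℂ] W))) ∈
      complexLieAlg ρ := by
  by_contra hne
  obtain ⟨ℓ, hℓ, hker⟩ := Submodule.exists_le_ker_of_notMem hne
  let f : ℂ → ℂ := fun z => ℓ (NormedSpace.exp (z • (s : W →L[ℂ] W)) * b *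
    NormedSpace.exp (-(z • (s : W →L[ℂ] W))))
  have hfd : Differentiable ℂ f := by
    have h1 : Differentiable ℂ fun z : ℂ => NormedSpace.exp (z • (s : W →L[ℂ] W)) := fun z =>
      (hasDerivAt_exp_smul_const (𝕂 := ℂ) (s : W →L[ℂ] W) z).differentiableAt
    have h2 : Differentiable ℂ fun z : ℂ => NormedSpace.exp (-(z • (s : W →L[ℂ] W))) := by
      intro z
      have := (hasDerivAt_exp_smul_const (𝕂 := ℂ) (-(s : W →L[ℂ] W)) z).differentiableAt
      simpa using this
    have h3 : Differentiable ℂ (ℓ.toContinuousLinearMap : (W →L[ℂ] W) →L[ℂ] ℂ) :=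
      ContinuousLinearMap.differentiable _
    exact h3.comp ((h1.mul_const b).mul h2)
  have hreal : ∀ t : ℝ, f t = 0 := by
    intro t
    obtain ⟨k, hk⟩ := s.2 t
    have hmem : ∀ c ∈ complexLieAlg ρ, NormedSpace.exp ((t : ℂ) • (s : W →L[ℂ] W)) * c *
        NormedSpace.exp (-((t : ℂ) • (s : W →L[ℂ] W))) ∈ complexLieAlg ρ := by
      intro c hc
      induction hc using Submodule.span_induction with
      | mem x hx =>
        have := (adj ρ k ⟨x, hx⟩).2
        simp only [adj, hk] at this
        exact Submodule.subset_span this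
      | zero => simp
      | add x y _ _ hx hy => rw [mul_add, add_mul]; exact add_mem hx hy
      | smul a x _ hx => rw [mul_smul_comm, smul_mul_assoc]; exact Submodule.smul_mem _ _ hx
    exact hker (hmem b hb)
  have hzero : f = 0 := by
    refine AnalyticOnNhd.eq_of_frequently_eq (𝕜 := ℂ) (z₀ := 0)
      (fun z _ => hfd.analyticAt z) (fun z _ => analyticAt_const) ?_
    have h4 : Filter.Tendsto (fun t : ℝ => (t : ℂ)) (𝓝[≠] 0) (𝓝[≠] 0) := by
      refine tendsto_nhdsWithin_iff.2 ⟨?_, ?_⟩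
      · exact (Complex.continuous_ofReal.tendsto' 0 0 (by simp)).mono_left nhdsWithin_le_nhds
      · filter_upwards [self_mem_nhdsWithin] with t ht
        simpa using ht
    exact h4.frequently (Filter.Eventually.frequently (Filter.Eventually.of_forall hreal))
  exact hℓ (congrFun hzero z)

/-- `𝔨` is closed under the commutator, being closed and stable under the adjoint action of `K`. -/
theorem bracket_mem [FiniteDimensional ℂ W] (s r : lieAlg ρ) :
    (s : W →L[ℂ] W) * r - r * s ∈ lieAlg ρ := by
  have h1 : HasDerivAt (fun t : ℝ => NormedSpace.exp (t • -(r : W →L[ℂ] W)) * s *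
      NormedSpace.exp (t • (r : W →L[ℂ] W))) ((s : W →L[ℂ] W) * r - r * s) 0 := by
    refine (((hasDerivAt_exp_smul_const (𝕂 := ℝ) (-(r : W →L[ℂ] W)) (0 : ℝ)).mul_const
      (s : W →L[ℂ] W)).mul
      (hasDerivAt_exp_smul_const (𝕂 := ℝ) (r : W →L[ℂ] W) (0 : ℝ))).congr_deriv ?_
    simp; abel
  have h2 : ∀ t : ℝ, NormedSpace.exp (t • -(r : W →L[ℂ] W)) * s *
      NormedSpace.exp (t • (r : W →L[ℂ] W)) ∈ lieAlg ρ := by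
    intro t
    obtain ⟨k, hk⟩ := r.2 (-t)
    have := (adj ρ k s).2
    simp only [adj, hk] at this
    convert this using 2
    · simp [expUnit]
    · change _ = NormedSpace.exp _
      simp
  rw [hasDerivAt_iff_tendsto_slope_zero] at h1
  refine (Submodule.closed_of_finiteDimensional (lieAlg ρ)).mem_of_tendsto h1
    (Filter.Eventually.of_forall fun t => ?_)
  exact (lieAlg ρ).smul_mem _ (sub_mem (h2 _) (h2 _))

end LieAlgebra

section Beta

variable {W : Type*} [NormedAddCommGroup W] [InnerProductSpace ℂ W] [CompleteSpace W]
  [FiniteDimensional ℂ W]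
  {K : Type*} [Group K] [TopologicalSpace K] [CompactSpace K] {ρ : K →ₜ* unitary (W →L[ℂ] W)}

/-- Conjugation by `exp(iuσ)` on `𝔤`, for `σ ∈ 𝔨` and real `u`. -/
def conjI (σ : lieAlg ρ) (u : ℝ) (b : complexLieAlg ρ) : complexLieAlg ρ :=
  ⟨NormedSpace.exp (u • (inclI ρ σ : W →L[ℂ] W)) * b *
    NormedSpace.exp (-(u • (inclI ρ σ : W →L[ℂ] W))), by
    have := conj_exp_mem σ (u * Complex.I) b.2
    simpa [mul_smul] using this⟩

theorem coe_conjI (σ : lieAlg ρ) (u : ℝ) (b : complexLieAlg ρ) : (conjI σ u b : W →L[ℂ] W) =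
    NormedSpace.exp (u • (inclI ρ σ : W →L[ℂ] W)) * b *
    NormedSpace.exp (-(u • (inclI ρ σ : W →L[ℂ] W))) := rfl

theorem continuous_conjI (σ : lieAlg ρ) (b : complexLieAlg ρ) :
    Continuous fun u => conjI σ u b := by
  have := (contDiff_exp (W := W)).continuous
  refine Continuous.subtype_mk ?_ _
  fun_prop

/-- The element `β(u) = ∫₀ᵘ e^{ivσ} (iη) e^{-ivσ} dv` of `𝔤`: the logarithmic derivative
`(d exp(iuσ)) exp(-iuσ)` under the variation of `σ` in the direction `η`, see `fderiv_exp_inclI`. -/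
def beta (σ η : lieAlg ρ) (u : ℝ) : complexLieAlg ρ :=
  ∫ v in (0 : ℝ)..u, conjI σ v (inclI ρ η)

theorem hasDerivAt_beta (σ η : lieAlg ρ) (u : ℝ) :
    HasDerivAt (beta σ η) (conjI σ u (inclI ρ η)) u :=
  ((continuous_conjI σ (inclI ρ η)).integral_hasStrictDerivAt 0 u).hasDerivAt

theorem integral_smul_comp_one_sub_mul {V : Type*} [NormedAddCommGroup V] [NormedSpace ℝ V]
    (c : ℝ → V) (u : ℝ) :
    ∫ v in (0 : ℝ)..1, u • c ((1 - v) * u) = ∫ v in (0 : ℝ)..u, c v := by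
  rw [intervalIntegral.integral_smul,
    intervalIntegral.integral_comp_sub_left (fun v => c (v * u)) 1]
  simp

/-- `conjI σ u (iη) = iη + [iσ, β(u)]`: both sides have the same derivative in `u`. -/
theorem coe_conjI_inclI (σ η : lieAlg ρ) (u : ℝ) :
    (conjI σ u (inclI ρ η) : W →L[ℂ] W) = inclI ρ η +
      ((inclI ρ σ : W →L[ℂ] W) * beta σ η u - beta σ η u * (inclI ρ σ : W →L[ℂ] W)) := by
  set p : W →L[ℂ] W := ↑(inclI ρ σ) with hp
  let D : ℝ → W →L[ℂ] W := fun u => (conjI σ u (inclI ρ η) : W →L[ℂ] W) -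
    (p * beta σ η u - beta σ η u * p)
  have hβ : ∀ u, HasDerivAt (fun u => (beta σ η u : W →L[ℂ] W)) (conjI σ u (inclI ρ η)) u :=
    fun u => (((complexLieAlg ρ).subtypeL.restrictScalars ℝ).hasFDerivAt).comp_hasDerivAt u
      (hasDerivAt_beta σ η u)
  have hD : ∀ u, HasDerivAt D 0 u := by
    intro u
    have h1 := ((hasDerivAt_exp_smul_const' (𝕂 := ℝ) p u).mul_const
      (inclI ρ η : W →L[ℂ] W)).mul (hasDerivAt_exp_smul_const (𝕂 := ℝ) (-p) u)
    have h2 := h1.sub (((hβ u).const_mul p).sub ((hβ u).mul_const p))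
    refine (h2.congr_of_eventuallyEq (Filter.Eventually.of_forall fun t => ?_)).congr_deriv ?_
    · simp [D, coe_conjI, hp]
    · simp only [coe_conjI, ← hp, smul_neg]; noncomm_ring
  have hconst := is_const_of_deriv_eq_zero (fun u => (hD u).differentiableAt)
    (fun u => (hD u).deriv) u 0
  simp only [D] at hconst
  rw [sub_eq_iff_eq_add] at hconst
  rw [hconst]
  simp [beta, coe_conjI]

/-- The derivative in `u` of the `i𝔨`-component of `β(u)`. -/
theorem hasDerivAt_imP_beta (σ η : lieAlg ρ) (u : ℝ) :
    HasDerivAt (fun u => imP ρ (beta σ η u))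
      (η + ⟨_, bracket_mem σ (reP ρ (beta σ η u))⟩) u := by
  have h1 := ((imP ρ).toContinuousLinearMap.hasFDerivAt).comp_hasDerivAt u (hasDerivAt_beta σ η u)
  refine h1.congr_deriv ?_
  set b := beta σ η u with hb
  have h2 : conjI σ u (inclI ρ η) = inclI ρ (η + ⟨_, bracket_mem σ (reP ρ b)⟩) -
      inclₗ ρ ⟨_, bracket_mem σ (imP ρ b)⟩ := by
    ext1
    rw [coe_conjI_inclI, ← hb]
    have h3 : (b : W →L[ℂ] W) = reP ρ b + Complex.I • (imP ρ b : W →L[ℂ] W) := by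
      conv_lhs => rw [← reP_add_imP b]
      rfl
    have h4 : ∀ y : W →L[ℂ] W, Complex.I • Complex.I • y = -y := by
      intro y; rw [smul_smul, Complex.I_mul_I, neg_one_smul]
    rw [h3]
    simp only [coe_inclI, Submodule.coe_sub, Submodule.coe_add, coe_inclₗ, smul_add, mul_add,
      add_mul, smul_mul_assoc, mul_smul_comm, smul_sub, h4]
    abel
  rw [h2]
  simp

theorem fderiv_exp_inclI (σ η : lieAlg ρ) (u : ℝ) :
    fderiv ℝ NormedSpace.exp (u • (inclI ρ σ : W →L[ℂ] W)) (u • (inclI ρ η : W →L[ℂ] W)) =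
      beta σ η u * NormedSpace.exp (u • (inclI ρ σ : W →L[ℂ] W)) := by
  rw [fderiv_exp_eq_integral, beta,
    ← integral_smul_comp_one_sub_mul (fun v => conjI σ v (inclI ρ η)) u]
  have hc : Continuous fun v : ℝ => u • conjI σ ((1 - v) * u) (inclI ρ η) := by
    have := (continuous_conjI σ (inclI ρ η))
    have h2 : Continuous fun v : ℝ => (1 - v) * u := by fun_prop
    exact (this.comp h2).const_smul u
  have h1 := ((complexLieAlg ρ).subtypeL.restrictScalars ℝ).intervalIntegral_comp_comm
    (hc.intervalIntegrable 0 1 (μ := MeasureTheory.volume))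
  simp only [ContinuousLinearMap.coe_restrictScalars', Submodule.subtypeL_apply] at h1
  rw [← h1]
  have h2 := ((ContinuousLinearMap.mul ℝ (W →L[ℂ] W)).flip
    (NormedSpace.exp (u • (inclI ρ σ : W →L[ℂ] W)))).intervalIntegral_comp_comm
    ((continuous_subtype_val.comp hc).intervalIntegrable 0 1 (μ := MeasureTheory.volume))
  simp only [ContinuousLinearMap.flip_apply, ContinuousLinearMap.mul_apply'] at h2
  refine Eq.trans ?_ h2
  refine intervalIntegral.integral_congr fun v _ => ?_
  set p : W →L[ℂ] W := ↑(inclI ρ σ) with hp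
  have h3 : (v * u) • p = -(((1 - v) * u) • p) + u • p := by module
  have h4 : NormedSpace.exp ((v * u) • p) = NormedSpace.exp (-(((1 - v) * u) • p)) *
      NormedSpace.exp (u • p) := by
    rw [h3, exp_add_eq_mul_of_commute]
    exact (((Commute.refl p).smul_left _).smul_right _).neg_left
  simp only [Function.comp_apply, coe_real_smul, coe_conjI, h4, smul_smul, ← hp, mul_smul_comm,
    smul_mul_assoc, mul_assoc]

variable (ρ) in
/-- The map `η ↦ Im β`, with `β` the logarithmic derivative of `exp(iσ)` in the direction `η`. -/
def imBeta (σ η : lieAlg ρ) : lieAlg ρ := imP ρ (beta σ η 1)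

theorem coe_beta_one (σ η : lieAlg ρ) : (beta σ η 1 : W →L[ℂ] W) =
    fderiv ℝ NormedSpace.exp (inclI ρ σ : W →L[ℂ] W) (inclI ρ η : W →L[ℂ] W) *
      NormedSpace.exp (-(inclI ρ σ : W →L[ℂ] W)) := by
  have h := fderiv_exp_inclI σ η 1
  simp only [one_smul] at h
  rw [h, mul_assoc, exp_mul_exp_neg, mul_one]

/-- Every element of `𝔨` is the imaginary part of a logarithmic derivative of `exp(iσ)`. It follows
that the map `(k, σ) ↦ k exp(iσ)` is a submersion from `K × 𝔨` to `G`. -/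
theorem imBeta_surjective (σ : lieAlg ρ) : Function.Surjective (imBeta ρ σ) := by
  have hlin : ∀ a b : lieAlg ρ, beta σ (a + b) 1 = beta σ a 1 + beta σ b 1 := by
    intro a b
    ext1
    simp only [coe_beta_one, Submodule.coe_add, map_add, add_mul]
  have hlin' : ∀ (a : ℝ) (b : lieAlg ρ), beta σ (a • b) 1 = a • beta σ b 1 := by
    intro a b
    ext1
    simp only [coe_beta_one, coe_real_smul, map_smul, smul_mul_assoc]
  let T : lieAlg ρ →ₗ[ℝ] lieAlg ρ :=
    { toFun := imBeta ρ σ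
      map_add' := fun a b => by simp [imBeta, hlin]
      map_smul' := fun a b => by simp [imBeta, hlin'] }
  suffices h : Function.Injective T from LinearMap.injective_iff_surjective.1 h
  rw [injective_iff_map_eq_zero]
  intro η hη
  -- `β` is skew and `β e^p` is Hermitian, so `β` anticommutes with `e^p`
  set p : W →L[ℂ] W := ↑(inclI ρ σ) with hp
  have hps : IsSelfAdjoint p := isSelfAdjoint_I_smul σ
  set b : W →L[ℂ] W := ↑(beta σ η 1) with hb
  have hbs : star b = -b := by
    rw [hb, coe_eq_of_imP_eq_zero hη, star_lieAlg]
  set e : W →L[ℂ] W := NormedSpace.exp p with he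
  have hes : star e = e := by rw [he, NormedSpace.star_exp, hps.star_eq]
  have hD : fderiv ℝ NormedSpace.exp p (inclI ρ η : W →L[ℂ] W) = b * e := by
    have := fderiv_exp_inclI σ η 1
    simp only [one_smul] at this
    exact this
  have h1 : star (b * e) = b * e := by
    rw [← hD]; exact isSelfAdjoint_fderiv_exp hps (isSelfAdjoint_I_smul η)
  rw [star_mul, hbs, hes, mul_neg] at h1
  have h2 : Commute (NormedSpace.exp ((2 : ℝ) • p)) b := by
    rw [two_smul, exp_add_eq_mul_of_commute (Commute.refl p), ← he]
    rw [Commute, SemiconjBy, mul_assoc, ← neg_eq_iff_eq_neg.2 h1.symm, mul_neg, ← mul_assoc,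
      ← neg_eq_iff_eq_neg.2 h1.symm, neg_mul, neg_neg, mul_assoc]
  have h3 : Commute ((2 : ℝ) • p) b := by
    have := h2.cfc_real Real.log
    rwa [← CFC.log, CFC.log_exp _ (isSelfAdjoint_real_smul hps 2)] at this
  have h4 : Commute p b := by
    have := h3.smul_left (2⁻¹ : ℝ)
    rwa [smul_smul, inv_mul_cancel₀ two_ne_zero, one_smul] at this
  have h5 : e * b = b * e := (h4.exp_left).eq
  have h6 : b * e = 0 := by
    rw [h5] at h1
    have h : (2 : ℝ) • (b * e) = 0 := by
      rw [two_smul]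
      nth_rewrite 1 [← h1]
      exact neg_add_cancel _
    exact (smul_eq_zero.1 h).resolve_left two_ne_zero
  have h7 : (inclI ρ η : W →L[ℂ] W) = 0 := by
    refine fderiv_exp_injective hps ?_
    rw [hD, h6, map_zero]
  have h8 : inclI ρ η = 0 := by ext1; exact h7
  rw [← imP_inclI η, h8, map_zero]

end Beta

/-! ### The polar decomposition `G = K exp(i𝔨)` -/

section Polar

variable {W : Type*} [NormedAddCommGroup W] [InnerProductSpace ℂ W] [CompleteSpace W]
  [FiniteDimensional ℂ W]
  {K : Type*} [Group K] [TopologicalSpace K] [CompactSpace K] {ρ : K →ₜ* unitary (W →L[ℂ] W)}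

variable (ρ) in
/-- The set of the pairs `(g, g⁻¹)` with `g ∈ K exp(i𝔨)`. Recording the inverse makes this set
closed in `End(W) × End(W)`. -/
def polarPairs : Set ((W →L[ℂ] W) × (W →L[ℂ] W)) :=
  {q | ∃ (k : K) (σ : lieAlg ρ),
    q = ((toGL ρ k : (W →L[ℂ] W)ˣ) * NormedSpace.exp (inclI ρ σ : W →L[ℂ] W),
      NormedSpace.exp (-(inclI ρ σ : W →L[ℂ] W)) * ((toGL ρ k)⁻¹ : (W →L[ℂ] W)ˣ))}

theorem star_mul_self_polar (k : K) (σ : lieAlg ρ) :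
    star ((toGL ρ k : (W →L[ℂ] W)ˣ) * NormedSpace.exp (inclI ρ σ : W →L[ℂ] W)) *
      ((toGL ρ k : (W →L[ℂ] W)ˣ) * NormedSpace.exp (inclI ρ σ : W →L[ℂ] W)) =
    NormedSpace.exp (inclI ρ σ : W →L[ℂ] W) * NormedSpace.exp (inclI ρ σ : W →L[ℂ] W) := by
  rw [star_mul, NormedSpace.star_exp, (isSelfAdjoint_inclI σ).star_eq, mul_assoc,
    ← mul_assoc (star _), star_toGL_mul, one_mul]

/-- The set is closed because its elements `(g, g⁻¹)` are characterized by `l = log (g* g) / 2 ∈ i𝔨`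
and `g exp(-l) ∈ K`, where the logarithm is continuous on invertible operators. -/
theorem isClosed_polarPairs : IsClosed (polarPairs ρ) := by
  let C : Set ((W →L[ℂ] W) × (W →L[ℂ] W)) := {q | q.1 * q.2 = 1 ∧ q.2 * q.1 = 1}
  let l : (W →L[ℂ] W) × (W →L[ℂ] W) → W →L[ℂ] W := fun q => (1 / 2 : ℝ) • CFC.log (star q.1 * q.1)
  let f : (W →L[ℂ] W) × (W →L[ℂ] W) → (W →L[ℂ] W) × (W →L[ℂ] W) := fun q =>
    (-Complex.I • l q, q.1 * NormedSpace.exp (-l q))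
  have hC : IsClosed C :=
    (isClosed_eq (by fun_prop) continuous_const).inter (isClosed_eq (by fun_prop) continuous_const)
  have hunit : ∀ q ∈ C, IsUnit q.1 := fun q hq => ⟨⟨q.1, q.2, hq.1, hq.2⟩, rfl⟩
  have hl : ContinuousOn l C := by
    have hl0 : ContinuousOn (fun q : (W →L[ℂ] W) × (W →L[ℂ] W) => CFC.log (star q.1 * q.1)) C :=
      (CFC.continuousOn_log (A := W →L[ℂ] W)).comp (Continuous.continuousOn (by fun_prop))
        fun q hq => ⟨IsSelfAdjoint.star_mul_self q.1, (hunit q hq).star.mul (hunit q hq)⟩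
    exact hl0.const_smul (1 / 2 : ℝ)
  have hf : ContinuousOn f C :=
    (hl.const_smul (-Complex.I)).prodMk (continuous_fst.continuousOn.mul
      ((contDiff_exp (W := W)).continuous.comp_continuousOn hl.neg))
  have hT : IsClosed ((lieAlg ρ : Set (W →L[ℂ] W)) ×ˢ
      Set.range fun k : K => ((toGL ρ k : (W →L[ℂ] W)ˣ) : W →L[ℂ] W)) :=
    (Submodule.closed_of_finiteDimensional (lieAlg ρ)).prod (isClosed_range_toGL ρ)
  have hP := hf.preimage_isClosed_of_isClosed hC hT
  convert hP using 1
  ext q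
  constructor
  · rintro ⟨k, σ, rfl⟩
    have hlq : l ((toGL ρ k : (W →L[ℂ] W)ˣ) * NormedSpace.exp (inclI ρ σ : W →L[ℂ] W),
        NormedSpace.exp (-(inclI ρ σ : W →L[ℂ] W)) * ((toGL ρ k)⁻¹ : (W →L[ℂ] W)ˣ)) =
        (inclI ρ σ : W →L[ℂ] W) := by
      simp only [l]
      rw [star_mul_self_polar, exp_mul_exp_self,
        CFC.log_exp _ (isSelfAdjoint_real_smul (isSelfAdjoint_inclI σ) 2), smul_smul]
      norm_num
    refine ⟨⟨?_, ?_⟩, ?_, ?_⟩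
    · rw [mul_assoc, ← mul_assoc (NormedSpace.exp _), exp_mul_exp_neg, one_mul, Units.mul_inv]
    · rw [mul_assoc, ← mul_assoc (((toGL ρ k)⁻¹ : (W →L[ℂ] W)ˣ) : W →L[ℂ] W), Units.inv_mul,
        one_mul, exp_neg_mul_exp]
    · change -Complex.I • l _ ∈ lieAlg ρ
      rw [hlq, coe_inclI, smul_smul]
      simp
    · refine ⟨k, ?_⟩
      change _ = _ * NormedSpace.exp (-l _)
      rw [hlq, mul_assoc, exp_mul_exp_neg, mul_one]
  · rintro ⟨hq, h1, k, hk⟩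
    have hlq : ((inclI ρ ⟨_, h1⟩ : complexLieAlg ρ) : W →L[ℂ] W) = l q := by
      rw [coe_inclI]
      change Complex.I • -Complex.I • l q = l q
      rw [smul_smul]; simp
    have e1 : ((toGL ρ k : (W →L[ℂ] W)ˣ) : W →L[ℂ] W) * NormedSpace.exp (l q) = q.1 := by
      change ((toGL ρ k : (W →L[ℂ] W)ˣ) : W →L[ℂ] W) = q.1 * NormedSpace.exp (-l q) at hk
      rw [hk, mul_assoc, exp_neg_mul_exp, mul_one]
    refine ⟨k, ⟨_, h1⟩, ?_⟩
    rw [hlq, e1]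
    refine Prod.ext rfl ?_
    calc q.2 = (NormedSpace.exp (-l q) * ((toGL ρ k)⁻¹ : (W →L[ℂ] W)ˣ)) *
          (((toGL ρ k : (W →L[ℂ] W)ˣ) : W →L[ℂ] W) * NormedSpace.exp (l q)) * q.2 := by
          rw [mul_assoc (NormedSpace.exp (-l q)), ← mul_assoc
            (((toGL ρ k)⁻¹ : (W →L[ℂ] W)ˣ) : W →L[ℂ] W), Units.inv_mul, one_mul,
            exp_neg_mul_exp, one_mul]
      _ = _ := by rw [e1, mul_assoc, hq.1, mul_one]

theorem polarPairs_inverse {q : (W →L[ℂ] W) × (W →L[ℂ] W)} (hq : q ∈ polarPairs ρ) :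
    q.1 * q.2 = 1 ∧ q.2 * q.1 = 1 := by
  obtain ⟨k, σ, rfl⟩ := hq
  constructor
  · rw [mul_assoc, ← mul_assoc (NormedSpace.exp _), exp_mul_exp_neg, one_mul, Units.mul_inv]
  · rw [mul_assoc, ← mul_assoc (((toGL ρ k)⁻¹ : (W →L[ℂ] W)ˣ) : W →L[ℂ] W), Units.inv_mul,
      one_mul, exp_neg_mul_exp]

/-- The left-invariant directions `g ξ`, `ξ ∈ 𝔤`, are tangent to `K exp(i𝔨)`. -/
theorem exists_curve_polarPairs {q : (W →L[ℂ] W) × (W →L[ℂ] W)} (hq : q ∈ polarPairs ρ)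
    (ξ : complexLieAlg ρ) : ∃ c : ℝ → (W →L[ℂ] W) × (W →L[ℂ] W), c 0 = q ∧
      (∀ t, c t ∈ polarPairs ρ) ∧ HasDerivAt c (q.1 * ξ, -(ξ * q.2)) 0 := by
  obtain ⟨k, σ, hkσ⟩ := hq
  obtain ⟨η, hη⟩ := imBeta_surjective σ (imP ρ (conjI σ 1 ξ))
  have ha : imP ρ (conjI σ 1 ξ - beta σ η 1) = 0 := by
    rw [map_sub, ← hη, imBeta, sub_self]
  set a := reP ρ (conjI σ 1 ξ - beta σ η 1) with ha_def
  have hac := coe_eq_of_imP_eq_zero ha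
  rw [← ha_def] at hac
  choose l hl using a.2
  set p : W →L[ℂ] W := ↑(inclI ρ σ) with hp
  have hlc : ∀ t : ℝ, ((toGL ρ (l t) : (W →L[ℂ] W)ˣ) : W →L[ℂ] W) =
      NormedSpace.exp (t • (a : W →L[ℂ] W)) := fun t => by rw [hl]; rfl
  let c : ℝ → (W →L[ℂ] W) × (W →L[ℂ] W) := fun t =>
    ((toGL ρ (k * l t) : (W →L[ℂ] W)ˣ) * NormedSpace.exp (inclI ρ (σ + t • η) : W →L[ℂ] W),
      NormedSpace.exp (-(inclI ρ (σ + t • η) : W →L[ℂ] W)) *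
        ((toGL ρ (k * l t))⁻¹ : (W →L[ℂ] W)ˣ))
  have hcP : ∀ t, c t ∈ polarPairs ρ := fun t => ⟨_, _, rfl⟩
  have hl0 : toGL ρ (l 0) = 1 := by
    rw [hl]; ext1; simp [expUnit]
  have hc0 : c 0 = q := by
    simp only [c, map_mul, hl0, mul_one, zero_smul, add_zero]
    exact hkσ.symm
  have hd1 : HasDerivAt (fun t => (c t).1) (q.1 * ξ) 0 := by
    have e1 := hasDerivAt_exp_smul_const (𝕂 := ℝ) (a : W →L[ℂ] W) (0 : ℝ)
    have e2 : HasDerivAt (fun t : ℝ => p + t • (inclI ρ η : W →L[ℂ] W)) (inclI ρ η) 0 := by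
      simpa using ((hasDerivAt_id (0 : ℝ)).smul_const (inclI ρ η : W →L[ℂ] W)).const_add p
    have e3 := (differentiable_exp (p + (0 : ℝ) • (inclI ρ η : W →L[ℂ] W))).hasFDerivAt
      |>.comp_hasDerivAt (0 : ℝ) e2
    have e4 := (e1.mul e3).const_mul ((toGL ρ k : (W →L[ℂ] W)ˣ) : W →L[ℂ] W)
    refine (e4.congr_of_eventuallyEq (Filter.Eventually.of_forall fun t => ?_)).congr_deriv ?_
    · simp only [c, map_mul, Units.val_mul, hlc, map_add, map_smul, Pi.mul_apply,
        Function.comp_apply, Submodule.coe_add, coe_real_smul, mul_assoc]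
      rfl
    · have e5 := fderiv_exp_inclI σ η 1
      simp only [one_smul] at e5
      rw [← hp] at e5
      simp only [zero_smul, add_zero, NormedSpace.exp_zero, one_mul, e5, Function.comp_apply]
      rw [← hac, Submodule.coe_sub, coe_conjI, one_smul, ← hp, hkσ]
      simp only [sub_mul, sub_add_cancel, mul_assoc, exp_neg_mul_exp, mul_one]
  have hd2 : HasDerivAt (fun t => (c t).2) (-(ξ * q.2)) 0 := by
    have hinv : ∀ t, (c t).2 = Ring.inverse (c t).1 := by
      intro t
      have h := polarPairs_inverse (hcP t)
      exact (Ring.inverse_unit ⟨(c t).1, (c t).2, h.1, h.2⟩).symm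
    have hq' := polarPairs_inverse (hcP 0)
    rw [hc0] at hq'
    have h1 : HasFDerivAt Ring.inverse
        (-ContinuousLinearMap.mulLeftRight ℝ (W →L[ℂ] W) q.2 q.2) (c 0).1 := by
      rw [hc0]
      exact hasFDerivAt_ringInverse (𝕜 := ℝ) (⟨q.1, q.2, hq'.1, hq'.2⟩ : (W →L[ℂ] W)ˣ)
    have h3 := h1.comp_hasDerivAt (0 : ℝ) hd1
    refine (h3.congr_of_eventuallyEq (Filter.Eventually.of_forall hinv)).congr_deriv ?_
    simp only [neg_apply, ContinuousLinearMap.mulLeftRight_apply]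
    rw [← mul_assoc q.2 q.1, hq'.2, one_mul]
  exact ⟨c, hc0, hcP, hd1.prodMk hd2⟩

/-- `K exp(i𝔨)` is stable under right multiplication by `exp ξ` for `ξ ∈ 𝔤`. The curve `g exp(tξ)`
starts in this closed set, to which its velocity field is tangent; hence its distance `f` to the set
satisfies the differential inequality `f' ≤ ‖ξ‖ f`, and so it vanishes. -/
theorem mul_exp_mem_polarPairs {q : (W →L[ℂ] W) × (W →L[ℂ] W)} (hq : q ∈ polarPairs ρ)
    (ξ : complexLieAlg ρ) :
    (q.1 * NormedSpace.exp (ξ : W →L[ℂ] W), NormedSpace.exp (-(ξ : W →L[ℂ] W)) * q.2) ∈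
      polarPairs ρ := by
  have : ProperSpace ((W →L[ℂ] W) × (W →L[ℂ] W)) := FiniteDimensional.proper ℝ _
  set x : W →L[ℂ] W := ↑ξ with hx
  let γ : ℝ → (W →L[ℂ] W) × (W →L[ℂ] W) := fun t =>
    (q.1 * NormedSpace.exp (t • x), NormedSpace.exp (t • -x) * q.2)
  have hγ : ∀ t, HasDerivAt γ ((γ t).1 * x, -(x * (γ t).2)) t := by
    intro t
    refine HasDerivAt.prodMk ?_ ?_
    · refine ((hasDerivAt_exp_smul_const (𝕂 := ℝ) x t).const_mul q.1).congr_deriv ?_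
      simp only [γ, mul_assoc]
    · refine ((hasDerivAt_exp_smul_const' (𝕂 := ℝ) (-x) t).mul_const q.2).congr_deriv ?_
      simp only [γ, mul_assoc, neg_mul]
  have hγc : Continuous γ := continuous_iff_continuousAt.2 fun t => (hγ t).continuousAt
  let f : ℝ → ℝ := fun t => Metric.infDist (γ t) (polarPairs ρ)
  have hne : (polarPairs ρ).Nonempty := ⟨q, hq⟩
  have hg := le_gronwallBound_of_liminf_deriv_right_le (f := f) (f' := fun t => ‖x‖ * f t)
    (δ := 0) (K := ‖x‖) (ε := 0) (a := 0) (b := 1)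
    ((Metric.continuous_infDist_pt _).comp hγc).continuousOn
    (by
      intro t _ r hr
      obtain ⟨y, hy, hyd⟩ := isClosed_polarPairs.exists_infDist_eq_dist hne (γ t)
      obtain ⟨c, hc0, hcP, hcd⟩ := exists_curve_polarPairs hy ξ
      have hcd' : HasDerivAt (fun z => c (z - t)) (y.1 * x, -(x * y.2)) t := by
        have := HasDerivAt.scomp t (h := fun z => z - t) (g₁ := c)
          (by rw [sub_self]; exact hcd) ((hasDerivAt_id t).sub_const t)
        simpa [Function.comp_def] using this
      have hw := ((hγ t).sub hcd').hasDerivWithinAt (s := Set.Ici t)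
      have hwn : ‖(((γ t).1 * x, -(x * (γ t).2)) - (y.1 * x, -(x * y.2)) :
          (W →L[ℂ] W) × (W →L[ℂ] W))‖ ≤ ‖x‖ * f t := by
        have e0 : f t = ‖γ t - y‖ := by rw [← dist_eq_norm]; exact hyd
        rw [e0, Prod.norm_def, Prod.norm_def]
        refine max_le ?_ ?_
        · change ‖(γ t).1 * x - y.1 * x‖ ≤ _
          rw [← sub_mul]
          refine (norm_mul_le _ _).trans ?_
          rw [mul_comm]
          exact mul_le_mul_of_nonneg_left (le_max_left _ _) (norm_nonneg _)
        · change ‖-(x * (γ t).2) - -(x * y.2)‖ ≤ _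
          rw [neg_sub_neg, norm_sub_rev, ← mul_sub]
          refine (norm_mul_le _ _).trans ?_
          exact mul_le_mul_of_nonneg_left (le_max_right _ _) (norm_nonneg _)
      have hfr := hw.liminf_right_slope_norm_le (hwn.trans_lt hr)
      refine (hfr.and_eventually self_mem_nhdsWithin).mono fun z hz => lt_of_le_of_lt ?_ hz.1
      have hzt : 0 < z - t := sub_pos.2 hz.2
      refine mul_le_mul_of_nonneg_left ?_ (inv_nonneg.2 hzt.le)
      refine sub_le_sub ?_ (le_of_eq ?_)
      · refine (Metric.infDist_le_dist_of_mem (hcP (z - t))).trans (le_of_eq ?_)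
        rw [dist_eq_norm]; rfl
      · change ‖γ t - c (t - t)‖ = _
        rw [sub_self, hc0, ← dist_eq_norm]; exact hyd.symm)
    (by simp only [f, γ]; simp [Metric.infDist_zero_of_mem hq])
    (fun t _ => by simp)
  have h1 := hg 1 (by simp)
  rw [gronwallBound_ε0_δ0] at h1
  have h2 := (isClosed_polarPairs.mem_iff_infDist_zero hne).2
    (le_antisymm h1 Metric.infDist_nonneg)
  simpa [γ] using h2

theorem exp_conj_inv (k : K) (σ : lieAlg ρ) :
    NormedSpace.exp (inclI ρ σ : W →L[ℂ] W) * (toGL ρ k : (W →L[ℂ] W)ˣ) =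
      (toGL ρ k : (W →L[ℂ] W)ˣ) * NormedSpace.exp (inclI ρ (adj ρ k⁻¹ σ) : W →L[ℂ] W) := by
  let _ : NormedAlgebra ℚ (W →L[ℂ] W) := NormedAlgebra.restrictScalars ℚ ℂ (W →L[ℂ] W)
  have h : ((inclI ρ (adj ρ k⁻¹ σ) : complexLieAlg ρ) : W →L[ℂ] W) =
      (((toGL ρ k)⁻¹ : (W →L[ℂ] W)ˣ) : W →L[ℂ] W) * (inclI ρ σ : W →L[ℂ] W) *
        ((toGL ρ k)⁻¹⁻¹ : (W →L[ℂ] W)ˣ) := by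
    simp only [coe_inclI, adj, map_inv, mul_smul_comm, smul_mul_assoc]
  rw [h, NormedSpace.exp_units_conj, inv_inv, mul_assoc, ← mul_assoc
    ((toGL ρ k : (W →L[ℂ] W)ˣ) : W →L[ℂ] W), Units.mul_inv, one_mul]

theorem polarPairs_of_mem {g : (W →L[ℂ] W)ˣ} (hg : g ∈ complexification ρ) :
    ((g : W →L[ℂ] W), ((g⁻¹ : (W →L[ℂ] W)ˣ) : W →L[ℂ] W)) ∈ polarPairs ρ := by
  have hK : ∀ (x : (W →L[ℂ] W)ˣ) (k : K),
      ((x : W →L[ℂ] W), ((x⁻¹ : (W →L[ℂ] W)ˣ) : W →L[ℂ] W)) ∈ polarPairs ρ →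
      (((x * toGL ρ k : (W →L[ℂ] W)ˣ) : W →L[ℂ] W),
        (((x * toGL ρ k)⁻¹ : (W →L[ℂ] W)ˣ) : W →L[ℂ] W)) ∈ polarPairs ρ := by
    rintro x k ⟨l, σ, h⟩
    have h1 : x = toGL ρ l * expUnit (inclI ρ σ : W →L[ℂ] W) := by
      ext1; exact congrArg Prod.fst h
    have h2 : x * toGL ρ k = toGL ρ (l * k) * expUnit (inclI ρ (adj ρ k⁻¹ σ) : W →L[ℂ] W) := by
      ext1
      rw [h1, map_mul]
      simp only [Units.val_mul, mul_assoc]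
      congr 1
      exact exp_conj_inv k σ
    refine ⟨l * k, adj ρ k⁻¹ σ, ?_⟩
    rw [h2, mul_inv_rev]
    rfl
  have hE : ∀ (x : (W →L[ℂ] W)ˣ) (ξ : complexLieAlg ρ),
      ((x : W →L[ℂ] W), ((x⁻¹ : (W →L[ℂ] W)ˣ) : W →L[ℂ] W)) ∈ polarPairs ρ →
      (((x * expUnit (ξ : W →L[ℂ] W) : (W →L[ℂ] W)ˣ) : W →L[ℂ] W),
        (((x * expUnit (ξ : W →L[ℂ] W))⁻¹ : (W →L[ℂ] W)ˣ) : W →L[ℂ] W)) ∈ polarPairs ρ := by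
    intro x ξ h
    have := mul_exp_mem_polarPairs h ξ
    rw [mul_inv_rev]
    exact this
  refine Subgroup.closure_induction_right (p := fun (g : (W →L[ℂ] W)ˣ) _ =>
    ((g : W →L[ℂ] W), ((g⁻¹ : (W →L[ℂ] W)ˣ) : W →L[ℂ] W)) ∈ polarPairs ρ) ?_ ?_ ?_ hg
  · exact ⟨1, 0, by simp⟩
  · rintro x _ y (⟨k, rfl⟩ | ⟨ξ, hξ, rfl⟩) h
    · exact hK x k h
    · exact hE x ⟨ξ, hξ⟩ h
  · rintro x _ y (⟨k, rfl⟩ | ⟨ξ, hξ, rfl⟩) h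
    · rw [← map_inv]; exact hK x k⁻¹ h
    · have h1 : (expUnit ξ)⁻¹ = expUnit (-ξ) := by ext1; rfl
      rw [h1]
      exact hE x ⟨-ξ, neg_mem hξ⟩ h

/-- The polar decomposition `G = K exp(i𝔨)`. -/
theorem exists_polar (g : complexification ρ) :
    ∃ (k : K) (σ : lieAlg ρ), g = toComplexification ρ k * expG ρ (inclI ρ σ) := by
  obtain ⟨k, σ, h⟩ := polarPairs_of_mem g.2
  refine ⟨k, σ, ?_⟩
  ext1; ext1
  exact congrArg Prod.fst h

/-- The polar decomposition of the curve `exp(its) h`: its Hermitian part is `exp(iσ(t))` with a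
differentiable curve `σ` in `𝔨`, whose logarithmic derivative is read off from `s`. -/
theorem exists_polar_curve (h : complexification ρ) (s : lieAlg ρ) :
    ∃ (k : ℝ → K) (σ σ' : ℝ → lieAlg ρ), ∀ t : ℝ,
      expG ρ (t • inclI ρ s) * h = toComplexification ρ (k t) * expG ρ (inclI ρ (σ t)) ∧
      HasDerivAt σ (σ' t) t ∧ imBeta ρ (σ t) (σ' t) = adj ρ (k t)⁻¹ s := by
  choose k σ hkσ using fun t : ℝ => exists_polar (expG ρ (t • inclI ρ s) * h)
  set p : W →L[ℂ] W := ↑(inclI ρ s) with hp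
  have hps : IsSelfAdjoint p := isSelfAdjoint_inclI s
  let g : ℝ → W →L[ℂ] W := fun t => NormedSpace.exp (t • p) * ((h : (W →L[ℂ] W)ˣ) : W →L[ℂ] W)
  have hg : ∀ t, g t = (toGL ρ (k t) : (W →L[ℂ] W)ˣ) *
      NormedSpace.exp (inclI ρ (σ t) : W →L[ℂ] W) := fun t =>
    congrArg (fun x : complexification ρ => (((x : (W →L[ℂ] W)ˣ)) : W →L[ℂ] W)) (hkσ t)
  have hgd : ∀ t, HasDerivAt g (p * g t) t := by
    intro t
    refine ((hasDerivAt_exp_smul_const' (𝕂 := ℝ) p t).mul_const _).congr_deriv ?_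
    simp only [g, mul_assoc]
  have hHd : ∀ t, HasDerivAt (fun t => star (g t) * g t) ((2 : ℝ) • (star (g t) * p * g t)) t := by
    intro t
    refine ((hgd t).star.mul (hgd t)).congr_deriv ?_
    rw [star_mul, hps.star_eq, two_smul]
    simp only [mul_assoc]
  have hH : ∀ t, star (g t) * g t = NormedSpace.exp (inclI ρ (σ t) : W →L[ℂ] W) *
      NormedSpace.exp (inclI ρ (σ t) : W →L[ℂ] W) := by
    intro t; rw [hg, star_mul_self_polar]
  obtain ⟨π, hπ⟩ := LinearMap.exists_leftInverse_of_injective (lieAlg ρ).subtype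
    (by simp)
  have hσd : ∀ t, ∃ σ' : lieAlg ρ, HasDerivAt σ σ' t := by
    intro t
    obtain ⟨p', hp', -⟩ := hasDerivAt_of_exp (p := fun t => (2 : ℝ) • (inclI ρ (σ t) : W →L[ℂ] W))
      (h := fun t => star (g t) * g t) (t := t)
      (fun t => isSelfAdjoint_real_smul (isSelfAdjoint_inclI (σ t)) 2)
      (fun t => by rw [hH, exp_mul_exp_self]) (hHd t)
      (continuous_iff_continuousAt.2 fun t => (hHd t).continuousAt)
    have h1 := (((hp'.const_smul (-Complex.I)).const_smul (1 / 2 : ℝ)))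
    have h2 := (π.toContinuousLinearMap.hasFDerivAt).comp_hasDerivAt t h1
    refine ⟨_, h2.congr_of_eventuallyEq (Filter.Eventually.of_forall fun r => ?_)⟩
    have h3 : (1 / 2 : ℝ) • -Complex.I • (2 : ℝ) • Complex.I • (σ r : W →L[ℂ] W) = σ r := by
      rw [smul_comm (-Complex.I), smul_smul, smul_smul (-Complex.I)]
      simp
    have h4 : π (σ r : W →L[ℂ] W) = σ r := LinearMap.congr_fun hπ (σ r)
    simp only [Function.comp_apply, Pi.smul_apply, coe_inclI]
    rw [h3]
    exact h4.symm
  choose σ' hσ' using hσd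
  refine ⟨k, σ, σ', fun t => ⟨hkσ t, hσ' t, ?_⟩⟩
  -- compare the two expressions of the derivative of `g* g = exp(iσ) exp(iσ)`
  set q : W →L[ℂ] W := ↑(inclI ρ (σ t)) with hq
  set e : W →L[ℂ] W := NormedSpace.exp q with he
  have hqs : IsSelfAdjoint q := isSelfAdjoint_inclI (σ t)
  have hes : star e = e := by rw [he, NormedSpace.star_exp, hqs.star_eq]
  set b := beta (σ t) (σ' t) 1 with hb
  have hD : fderiv ℝ NormedSpace.exp q (inclI ρ (σ' t) : W →L[ℂ] W) = b * e := by
    have := fderiv_exp_inclI (σ t) (σ' t) 1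
    simp only [one_smul] at this
    exact this
  have hD' : (b : W →L[ℂ] W) * e = e * star (b : W →L[ℂ] W) := by
    have := isSelfAdjoint_fderiv_exp hqs (isSelfAdjoint_inclI (σ' t))
    rw [hD, IsSelfAdjoint, star_mul, hes] at this
    exact this.symm
  have hE : HasDerivAt (fun r => NormedSpace.exp (inclI ρ (σ r) : W →L[ℂ] W)) (b * e) t := by
    have h1 : HasDerivAt (fun r => (inclI ρ (σ r) : W →L[ℂ] W)) (inclI ρ (σ' t)) t :=
      (((complexLieAlg ρ).subtypeL.restrictScalars ℝ).comp
        (inclI ρ).toContinuousLinearMap).hasFDerivAt.comp_hasDerivAt t (hσ' t)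
    have h2 := (differentiable_exp q).hasFDerivAt.comp_hasDerivAt t h1
    rw [hD] at h2
    exact h2
  have h1 := (hE.mul hE).unique ((hHd t).congr_of_eventuallyEq
    (Filter.Eventually.of_forall fun r => (hH r).symm))
  have hadj : ((inclI ρ (adj ρ (k t)⁻¹ s) : complexLieAlg ρ) : W →L[ℂ] W) =
      star ((toGL ρ (k t) : (W →L[ℂ] W)ˣ) : W →L[ℂ] W) * p * (toGL ρ (k t) : (W →L[ℂ] W)ˣ) := by
    have hinv : (((toGL ρ (k t))⁻¹ : (W →L[ℂ] W)ˣ) : W →L[ℂ] W) =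
        star ((toGL ρ (k t) : (W →L[ℂ] W)ˣ) : W →L[ℂ] W) :=
      rfl
    simp only [coe_inclI, adj, map_inv, hp, mul_smul_comm, smul_mul_assoc, hinv, inv_inv]
  have h2 : e * ((2 : ℝ) • (inclI ρ (imP ρ b) : W →L[ℂ] W)) * e =
      e * ((2 : ℝ) • (inclI ρ (adj ρ (k t)⁻¹ s) : W →L[ℂ] W)) * e := by
    rw [← add_star_eq, hadj, mul_add, add_mul, ← hD']
    refine Eq.trans ?_ (h1.trans ?_)
    · simp only [← hq, ← he, mul_assoc]; rw [add_comm]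
    · rw [hg t, star_mul, ← hq, ← he, hes]
      simp only [mul_assoc, mul_smul_comm, smul_mul_assoc]
  have h3 : (inclI ρ (imP ρ b) : W →L[ℂ] W) = inclI ρ (adj ρ (k t)⁻¹ s) := by
    have heu : IsUnit e := (expUnit q).isUnit
    have h4 := heu.mul_left_cancel (heu.mul_right_cancel h2)
    exact smul_right_injective _ (two_ne_zero (α := ℝ)) h4
  have h5 : inclI ρ (imP ρ b) = inclI ρ (adj ρ (k t)⁻¹ s) := by ext1; exact h3
  rw [imBeta, ← hb, ← imP_inclI (imP ρ b), h5, imP_inclI]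

end Polar

/-! ### Holomorphic maps as smooth real maps -/

section Scalars

variable {V E : Type*} [NormedAddCommGroup V] [NormedSpace ℂ V] [NormedAddCommGroup E]
  [NormedSpace ℂ E] {F : Type*} [TopologicalSpace F] [ChartedSpace E F]

theorem contMDiff_restrictScalars {f : V → F} (h : ContMDiff 𝓘(ℂ, V) 𝓘(ℂ, E) ω f) :
    ContMDiff 𝓘(ℝ, V) 𝓘(ℝ, E) ∞ f := by
  intro x
  have hx := contMDiffAt_iff.1 (h x)
  refine contMDiffAt_iff.2 ⟨hx.1, ?_⟩
  exact (hx.2.restrict_scalars ℝ).of_le le_top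

theorem hasMFDerivAt_restrictScalars {f : V → F} {x : V} {L : V →L[ℂ] E}
    (h : HasMFDerivAt 𝓘(ℂ, V) 𝓘(ℂ, E) f x L) :
    HasMFDerivAt 𝓘(ℝ, V) 𝓘(ℝ, E) f x (L.restrictScalars ℝ : V →L[ℝ] E) :=
  ⟨h.1, HasFDerivWithinAt.restrictScalars ℝ h.2⟩

/-- A curve in a Hausdorff complex manifold with vanishing derivative is constant. -/
theorem eq_of_hasMFDerivAt_zero [T2Space F] [IsManifold 𝓘(ℂ, E) ω F] {γ : ℂ → F}
    (h : ∀ z, HasMFDerivAt 𝓘(ℂ, ℂ) 𝓘(ℂ, E) γ z (0 : ℂ →L[ℂ] E)) (z w : ℂ) : γ z = γ w := by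
  have : IsManifold 𝓘(ℂ, E) 1 F := IsManifold.of_le (n := ω) le_top
  suffices hl : IsLocallyConstant γ from hl.apply_eq_of_preconnectedSpace z w
  rw [IsLocallyConstant.iff_eventually_eq]
  intro z₀
  have hc : Continuous γ := continuous_iff_continuousAt.2 fun z => (h z).continuousAt
  obtain ⟨r, hr, hball⟩ := Metric.isOpen_iff.1
    ((chartAt E (γ z₀)).open_source.preimage hc) z₀ (mem_chart_source E (γ z₀))
  have hd : ∀ y ∈ Metric.ball z₀ r, HasFDerivAt (extChartAt 𝓘(ℂ, E) (γ z₀) ∘ γ)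
      (0 : ℂ →L[ℂ] E) y := by
    intro y hy
    have h1 := (mdifferentiableAt_extChartAt (I := 𝓘(ℂ, E)) (hball hy)).hasMFDerivAt
    have h2 := (h1.comp y (h y)).hasFDerivAt
    exact h2.congr_fderiv (ContinuousLinearMap.ext fun v =>
      map_zero (mfderiv 𝓘(ℂ, E) 𝓘(ℂ, E) (extChartAt 𝓘(ℂ, E) (γ z₀)) (γ y)))
  filter_upwards [Metric.ball_mem_nhds z₀ hr] with y hy
  have h3 : (extChartAt 𝓘(ℂ, E) (γ z₀) ∘ γ) y = (extChartAt 𝓘(ℂ, E) (γ z₀) ∘ γ) z₀ :=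
    Metric.isOpen_ball.is_const_of_fderiv_eq_zero (convex_ball z₀ r).isPreconnected
      (fun y hy => (hd y hy).differentiableAt.differentiableWithinAt)
      (fun y hy => (hd y hy).fderiv) hy (Metric.mem_ball_self hr)
  refine (extChartAt 𝓘(ℂ, E) (γ z₀)).injOn ?_ ?_ h3
  · rw [extChartAt_source]; exact hball hy
  · exact mem_extChartAt_source _

end Scalars

theorem alternating_neg_right {E : Type*} [NormedAddCommGroup E] [NormedSpace ℂ E]
    (A : E [⋀^Fin 2]→L[ℝ] ℝ) (u v : E) : A ![u, -v] = A ![v, u] := by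
  have h1 := A.toAlternatingMap.map_swap ![v, u] (i := 0) (j := 1) (by simp)
  have e : (![v, u] : Fin 2 → E) ∘ Equiv.swap (0 : Fin 2) 1 = ![u, v] := by
    ext i; fin_cases i <;> simp
  rw [e] at h1
  have h2 := A.toAlternatingMap.map_update_neg ![u, v] 1 v
  have e1 : Function.update (![u, v] : Fin 2 → E) 1 (-v) = ![u, -v] := by
    ext i; fin_cases i <;> simp
  have e2 : Function.update (![u, v] : Fin 2 → E) 1 v = ![u, v] := by
    ext i; fin_cases i <;> simp
  rw [e1, e2, h1, neg_neg] at h2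
  exact h2

/-! ### The moment map along the orbits of `G` -/

section Orbit

variable {W : Type*} [NormedAddCommGroup W] [InnerProductSpace ℂ W] [CompleteSpace W]
  [FiniteDimensional ℂ W]
  {K : Type*} [Group K] [TopologicalSpace K] [CompactSpace K] {ρ : K →ₜ* unitary (W →L[ℂ] W)}

theorem expG_zero : expG ρ 0 = 1 := by
  ext1; ext1; exact NormedSpace.exp_zero

theorem expG_add_smul {𝕜 : Type*} [Semiring 𝕜] [Module 𝕜 (complexLieAlg ρ)]
    [Module 𝕜 (W →L[ℂ] W)] [IsScalarTower 𝕜 (W →L[ℂ] W) (W →L[ℂ] W)]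
    [SMulCommClass 𝕜 (W →L[ℂ] W) (W →L[ℂ] W)] (a : complexLieAlg ρ) (r e : 𝕜)
    (hc : ∀ r : 𝕜, ((r • a : complexLieAlg ρ) : W →L[ℂ] W) = r • (a : W →L[ℂ] W)) :
    expG ρ ((r + e) • a) = expG ρ (r • a) * expG ρ (e • a) := by
  ext1; ext1
  change NormedSpace.exp _ = NormedSpace.exp _ * NormedSpace.exp _
  rw [hc, hc, hc, add_smul, exp_add_eq_mul_of_commute (((Commute.refl _).smul_left r).smul_right e)]

theorem expG_add_real (a : complexLieAlg ρ) (r e : ℝ) :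
    expG ρ ((r + e) • a) = expG ρ (r • a) * expG ρ (e • a) :=
  expG_add_smul a r e fun _ => rfl

theorem expG_add_complex (a : complexLieAlg ρ) (r e : ℂ) :
    expG ρ ((r + e) • a) = expG ρ (r • a) * expG ρ (e • a) :=
  expG_add_smul a r e fun _ => rfl

theorem expG_conjI (σ : lieAlg ρ) (u : ℝ) (b : complexLieAlg ρ) :
    expG ρ (u • inclI ρ σ) * expG ρ b = expG ρ (conjI σ u b) * expG ρ (u • inclI ρ σ) := by
  ext1; ext1
  let _ : NormedAlgebra ℚ (W →L[ℂ] W) := NormedAlgebra.restrictScalars ℚ ℂ (W →L[ℂ] W)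
  change NormedSpace.exp (u • (inclI ρ σ : W →L[ℂ] W)) * _ = NormedSpace.exp _ *
    NormedSpace.exp (u • (inclI ρ σ : W →L[ℂ] W))
  have := NormedSpace.exp_units_conj (expUnit (u • (inclI ρ σ : W →L[ℂ] W))) (b : W →L[ℂ] W)
  rw [coe_conjI]
  refine Eq.trans ?_ (congrArg (· * NormedSpace.exp (u • (inclI ρ σ : W →L[ℂ] W))) this.symm)
  change _ = NormedSpace.exp (u • (inclI ρ σ : W →L[ℂ] W)) * _ *
    NormedSpace.exp (-(u • (inclI ρ σ : W →L[ℂ] W))) *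
    NormedSpace.exp (u • (inclI ρ σ : W →L[ℂ] W))
  rw [mul_assoc _ (NormedSpace.exp (-(u • (inclI ρ σ : W →L[ℂ] W)))), exp_neg_mul_exp, mul_one]
  rfl

theorem adj_adj_inv (k : K) (s : lieAlg ρ) : adj ρ k (adj ρ k⁻¹ s) = s := by
  ext1
  simp only [adj, map_inv, inv_inv, ← mul_assoc, Units.mul_inv, one_mul]
  rw [mul_assoc, Units.mul_inv, mul_one]

/-- The elements `exp(ts)` with `s ∈ 𝔨` and `t` real lie in `K`. -/
theorem exists_toComplexification_eq (s : lieAlg ρ) (t : ℝ) :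
    ∃ k : K, toComplexification ρ k = expG ρ (t • inclₗ ρ s) := by
  obtain ⟨k, hk⟩ := s.2 t
  exact ⟨k, by ext1; exact hk⟩

variable {E : Type*} [NormedAddCommGroup E] [NormedSpace ℂ E]
  {F : Type*} [TopologicalSpace F] [ChartedSpace E F]
  [MulAction K F] [MulAction (complexification ρ) F]

theorem contMDiff_expG_smul (hext : IsHolomorphicExtension ρ E F) {V : Type*}
    [NormedAddCommGroup V] [NormedSpace ℂ V] {a : V → complexLieAlg ρ} {y : V → F}
    (ha : ContDiff ℂ ω a) (hy : ContMDiff 𝓘(ℂ, V) 𝓘(ℂ, E) ω y) :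
    ContMDiff 𝓘(ℂ, V) 𝓘(ℂ, E) ω fun v => expG ρ (a v) • y v :=
  hext.mdiff_exp.comp (ha.contMDiff.prodMk hy)

theorem exists_hasMFDerivAt_expG (hext : IsHolomorphicExtension ρ E F) (z : F) :
    ∃ L : complexLieAlg ρ →L[ℂ] E,
      HasMFDerivAt 𝓘(ℂ, complexLieAlg ρ) 𝓘(ℂ, E) (fun a => expG ρ a • z) 0 L :=
  ⟨_, ((contMDiff_expG_smul hext contDiff_id contMDiff_const).mdifferentiable (by simp)
    0).hasMFDerivAt⟩

variable {μ : F → Module.Dual ℝ (lieAlg ρ)} {Ω : TwoForm E F}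

theorem contDiff_moment (hext : IsHolomorphicExtension ρ E F) (hμ : IsMomentMap ρ Ω μ) (z : F)
    (s : lieAlg ρ) : ContDiff ℝ 1 fun x : complexLieAlg ρ × complexLieAlg ρ × complexLieAlg ρ =>
      μ (expG ρ x.1 • expG ρ x.2.1 • expG ρ x.2.2 • z) s := by
  have h1 := contMDiff_expG_smul (V := complexLieAlg ρ × complexLieAlg ρ × complexLieAlg ρ) hext
    (a := fun x => x.1) contDiff_fst
    (contMDiff_expG_smul hext (a := fun x => x.2.1) (contDiff_fst.comp contDiff_snd)
      (contMDiff_expG_smul hext (a := fun x => x.2.2) (contDiff_snd.comp contDiff_snd)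
        (contMDiff_const (c := z))))
  have h2 := (hμ.smooth s).comp (contMDiff_restrictScalars h1)
  exact h2.contDiff.of_le (by simp)

/-- The derivative at `a = 0` of `a ↦ ⟨μ(exp(a) z), s⟩`, as a real-linear form on `𝔤`. -/
def dmoment (μ : F → Module.Dual ℝ (lieAlg ρ)) (z : F) (s : lieAlg ρ) :
    complexLieAlg ρ →L[ℝ] ℝ :=
  fderiv ℝ (fun a : complexLieAlg ρ => μ (expG ρ a • z) s) 0

theorem differentiable_moment (hext : IsHolomorphicExtension ρ E F) (hμ : IsMomentMap ρ Ω μ) (z : F)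
    (s : lieAlg ρ) : Differentiable ℝ fun a : complexLieAlg ρ => μ (expG ρ a • z) s := by
  have h1 := (contDiff_moment hext hμ z s).differentiable one_ne_zero
  have h2 : Differentiable ℝ fun a : complexLieAlg ρ =>
      ((a, 0, 0) : complexLieAlg ρ × complexLieAlg ρ × complexLieAlg ρ) := by fun_prop
  have := h1.comp h2
  simpa [Function.comp_def, expG_zero] using this

theorem hasDerivAt_moment (hext : IsHolomorphicExtension ρ E F) (hμ : IsMomentMap ρ Ω μ) (z : F)
    (s : lieAlg ρ) (a : complexLieAlg ρ) (t : ℝ) :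
    HasDerivAt (fun t : ℝ => μ (expG ρ (t • a) • z) s) (dmoment μ (expG ρ (t • a) • z) s a) t := by
  have h1 : HasDerivAt (fun r : ℝ => (r - t) • a) a t := by
    simpa using ((hasDerivAt_id t).sub_const t).smul_const a
  have h2 := (differentiable_moment hext hμ (expG ρ (t • a) • z) s ((t - t) • a)).hasFDerivAt
    |>.comp_hasDerivAt t h1
  rw [sub_self, zero_smul] at h2
  refine h2.congr_of_eventuallyEq (Filter.Eventually.of_forall fun r => ?_)
  simp only [Function.comp_apply]
  rw [smul_smul, ← expG_add_real, sub_add_cancel]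

/-- The derivative of `ξ ↦ μ(exp(ξ) z)` at `iuσ` in the direction `iuη`. -/
theorem fderiv_moment_inclI (hext : IsHolomorphicExtension ρ E F) (hμ : IsMomentMap ρ Ω μ) (z : F)
    (s σ η : lieAlg ρ) (u : ℝ) :
    fderiv ℝ (fun a : complexLieAlg ρ => μ (expG ρ a • z) s) (u • inclI ρ σ) (u • inclI ρ η) =
      dmoment μ (expG ρ (u • inclI ρ σ) • z) s (beta σ η u) := by
  have h := fderiv_eq_integral_duhamel (contDiff_moment hext hμ z s)
    (fun a c r e => by simp only [expG_zero, one_smul, expG_add_real, mul_smul])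
    (fun a c r e => by rw [add_comm r e]; simp only [expG_zero, one_smul, expG_add_real, mul_smul])
    (u • inclI ρ σ) (u • inclI ρ η)
  simp only [expG_zero, one_smul] at h
  rw [h, beta, ← integral_smul_comp_one_sub_mul (fun v => conjI σ v (inclI ρ η)) u]
  have hc : Continuous fun v : ℝ => u • conjI σ ((1 - v) * u) (inclI ρ η) := by
    have := (continuous_conjI σ (inclI ρ η))
    have h2 : Continuous fun v : ℝ => (1 - v) * u := by fun_prop
    exact (this.comp h2).const_smul u
  rw [← (dmoment μ (expG ρ (u • inclI ρ σ) • z) s).intervalIntegral_comp_comm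
    (hc.intervalIntegrable 0 1 (μ := MeasureTheory.volume))]
  refine intervalIntegral.integral_congr fun v _ => ?_
  -- `b ↦ e^{(1-v)uiσ} e^b e^{vuiσ} z` is `b ↦ e^{Ad b} e^{uiσ} z`
  set w := expG ρ (u • inclI ρ σ) • z with hw
  set r := (1 - v) * u with hr
  have hfun : (fun b : complexLieAlg ρ =>
      μ (expG ρ ((1 - v) • u • inclI ρ σ) • expG ρ b • expG ρ (v • u • inclI ρ σ) • z) s) =
      fun b => μ (expG ρ (conjI σ r b) • w) s := by
    ext1 b
    have hru : r + v * u = u := by rw [hr]; ring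
    rw [smul_smul (1 - v) u, smul_smul v u, ← hr, smul_smul (expG ρ (r • inclI ρ σ)), expG_conjI,
      mul_smul, smul_smul (expG ρ (r • inclI ρ σ)), ← expG_add_real, hru]
  let A : complexLieAlg ρ →ₗ[ℝ] complexLieAlg ρ :=
    { toFun := conjI σ r
      map_add' := fun a b => by
        ext1; simp only [coe_conjI, Submodule.coe_add, mul_add, add_mul]
      map_smul' := fun a b => by
        ext1
        simp only [coe_conjI, coe_real_smul, mul_smul_comm, smul_mul_assoc, RingHom.id_apply] }
  have hA0 : conjI σ r (0 : complexLieAlg ρ) = 0 := A.map_zero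
  have hd := differentiable_moment hext hμ w s (conjI σ r 0)
  have hcomp := hd.hasFDerivAt.comp (0 : complexLieAlg ρ) A.toContinuousLinearMap.hasFDerivAt
  have hf : fderiv ℝ (fun b => μ (expG ρ (conjI σ r b) • w) s) 0 = _ := hcomp.fderiv
  simp only [hfun, hf]
  rw [hA0]
  change dmoment μ w s (A (u • inclI ρ η)) = _
  rw [map_smul]
  rfl

/-- The derivative of the moment map in the direction of `K` is given by equivariance. -/
theorem dmoment_incl (hext : IsHolomorphicExtension ρ E F) (hμ : IsMomentMap ρ Ω μ) (z : F)
    (s r : lieAlg ρ) : dmoment μ z s (inclₗ ρ r) = μ z ⟨_, bracket_mem s r⟩ := by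
  have h1 := hasDerivAt_moment hext hμ z s (inclₗ ρ r) 0
  rw [zero_smul, expG_zero, one_smul] at h1
  obtain ⟨π, hπ⟩ := LinearMap.exists_leftInverse_of_injective (lieAlg ρ).subtype (by simp)
  have hπ' : ∀ a : lieAlg ρ, π (a : W →L[ℂ] W) = a := fun a => LinearMap.congr_fun hπ a
  have h2 : HasDerivAt (fun t : ℝ => NormedSpace.exp (t • -(r : W →L[ℂ] W)) * s *
      NormedSpace.exp (t • (r : W →L[ℂ] W))) ((s : W →L[ℂ] W) * r - r * s) 0 := by
    refine (((hasDerivAt_exp_smul_const (𝕂 := ℝ) (-(r : W →L[ℂ] W)) (0 : ℝ)).mul_const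
      (s : W →L[ℂ] W)).mul
      (hasDerivAt_exp_smul_const (𝕂 := ℝ) (r : W →L[ℂ] W) (0 : ℝ))).congr_deriv ?_
    simp; abel
  have h3 := ((μ z).comp π).toContinuousLinearMap.hasFDerivAt.comp_hasDerivAt (0 : ℝ) h2
  have h4 := h1.unique (h3.congr_of_eventuallyEq (Filter.Eventually.of_forall fun t => ?_))
  · rw [h4]
    change μ z (π _) = _
    rw [← hπ' ⟨_, bracket_mem s r⟩]
  · obtain ⟨k, hk⟩ := exists_toComplexification_eq r t
    have hk' : toGL ρ k = expUnit (t • (r : W →L[ℂ] W)) := congrArg Subtype.val hk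
    have h6 : (adj ρ k⁻¹ s : W →L[ℂ] W) = NormedSpace.exp (t • -(r : W →L[ℂ] W)) * s *
        NormedSpace.exp (t • (r : W →L[ℂ] W)) := by
      simp only [adj, map_inv, inv_inv, hk', smul_neg]
      rfl
    change μ (expG ρ (t • inclₗ ρ r) • z) s = _
    rw [← hk, hext.extends_action]
    conv_lhs => rw [← adj_adj_inv k s]
    rw [hμ.equivariant]
    exact congrArg (μ z) ((hπ' _).symm.trans (congrArg π h6))

/-- With `L : 𝔤 → T_z F` the infinitesimal action, which is complex linear, the Hamiltonian
condition on `μ` becomes `d⟨μ, s⟩(L β) = Ω(L s, L β)`. -/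
theorem dmoment_eq (hext : IsHolomorphicExtension ρ E F) (hμ : IsMomentMap ρ Ω μ) (z : F) :
    ∃ L : complexLieAlg ρ →L[ℂ] E,
      HasMFDerivAt 𝓘(ℂ, complexLieAlg ρ) 𝓘(ℂ, E) (fun a => expG ρ a • z) 0 L ∧
      ∀ (s : lieAlg ρ) (β : complexLieAlg ρ),
        dmoment μ z s β = Ω z ![(L (incl ρ s) : E), (L β : E)] := by
  obtain ⟨L, hL⟩ := exists_hasMFDerivAt_expG hext z
  refine ⟨L, hL, fun s β => ?_⟩
  have h0 : expG ρ (0 : complexLieAlg ρ) • z = z := by rw [expG_zero, one_smul]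
  have hLr : HasMFDerivAt 𝓘(ℝ, complexLieAlg ρ) 𝓘(ℝ, E) (fun a => expG ρ a • z) 0
      (L.restrictScalars ℝ : complexLieAlg ρ →L[ℝ] E) := hasMFDerivAt_restrictScalars hL
  have hLr' : ∀ a, a = 0 → HasMFDerivAt 𝓘(ℝ, complexLieAlg ρ) 𝓘(ℝ, E) (fun a => expG ρ a • z) a
      (L.restrictScalars ℝ : complexLieAlg ρ →L[ℝ] E) := by
    rintro _ rfl; exact hLr
  have hX : fundamentalField ρ E s z = L (incl ρ s) := by
    have h1 : HasFDerivAt (fun t : ℝ => (t : ℂ) • incl ρ s)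
        ((ContinuousLinearMap.id ℝ ℝ).smulRight (incl ρ s)) 0 := by
      have := ((ContinuousLinearMap.id ℝ ℝ).smulRight (incl ρ s)).hasFDerivAt (x := (0 : ℝ))
      exact this
    have h2 := HasMFDerivAt.comp (I := 𝓘(ℝ, ℝ)) (I' := 𝓘(ℝ, complexLieAlg ρ)) (I'' := 𝓘(ℝ, E))
      (0 : ℝ) (g := fun a => expG ρ a • z) (f := fun t : ℝ => (t : ℂ) • incl ρ s)
      (g' := L.restrictScalars ℝ)
      (hLr' _ (by simp)) h1.hasMFDerivAt
    have h3 := h2.mfderiv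
    unfold fundamentalField
    refine (congrArg (fun T : ℝ →L[ℝ] E => T 1) h3).trans ?_
    change L ((1 : ℝ) • incl ρ s) = _
    rw [one_smul]
  have hm : HasMFDerivAt 𝓘(ℝ, E) 𝓘(ℝ, ℝ) (fun y => μ y s) (expG ρ (0 : complexLieAlg ρ) • z)
      (mfderiv 𝓘(ℝ, E) 𝓘(ℝ, ℝ) (fun y => μ y s) z : E →L[ℝ] ℝ) := by
    rw [h0]
    exact ((hμ.smooth s).mdifferentiable (by simp) z).hasMFDerivAt
  let M : E →L[ℝ] ℝ := mfderiv 𝓘(ℝ, E) 𝓘(ℝ, ℝ) (fun y => μ y s) z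
  have h4 : HasFDerivAt (fun a : complexLieAlg ρ => μ (expG ρ a • z) s)
      (M.comp (L.restrictScalars ℝ)) 0 :=
    hasMFDerivAt_iff_hasFDerivAt.1 (HasMFDerivAt.comp (0 : complexLieAlg ρ) hm hLr)
  have h5 : dmoment μ z s β = mfderiv 𝓘(ℝ, E) 𝓘(ℝ, ℝ) (fun y => μ y s) z (L β : E) := by
    rw [dmoment, h4.fderiv]
    rfl
  refine h5.trans ((hμ.hamiltonian s z _).trans ?_)
  exact congrArg (fun u : E => Ω z ![u, (L β : E)]) hX

/-- The form `(s, r) ↦ Ω(L s, i L r)` on `𝔨` is symmetric by the invariance of `Ω` under the complex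
structure. -/
theorem dmoment_inclI_symm (hext : IsHolomorphicExtension ρ E F) (hΩ : IsKaehlerForm Ω)
    (hμ : IsMomentMap ρ Ω μ) (z : F) (s r : lieAlg ρ) :
    dmoment μ z s (inclI ρ r) = dmoment μ z r (inclI ρ s) := by
  obtain ⟨L, -, h⟩ := dmoment_eq hext hμ z
  have hI : ∀ s : lieAlg ρ, L (inclI ρ s) = Complex.I • L (incl ρ s) := fun s => by
    rw [← map_smul]; rfl
  rw [h, h, hI, hI]
  have hinv : ∀ u v : E, Ω z ![Complex.I • u, Complex.I • v] = Ω z ![u, v] := hΩ.invariant z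
  set u : E := L (incl ρ s)
  set v : E := L (incl ρ r)
  refine (hinv u (Complex.I • v)).symm.trans ?_
  rw [smul_smul, Complex.I_mul_I, neg_one_smul]
  exact alternating_neg_right (E := E) (Ω z) (Complex.I • u) v

/-- The form `(s, r) ↦ Ω(L s, i L r)` on `𝔨` is positive semidefinite, as the pull-back of the
Kähler metric. -/
theorem dmoment_inclI_nonneg (hext : IsHolomorphicExtension ρ E F) (hΩ : IsKaehlerForm Ω)
    (hμ : IsMomentMap ρ Ω μ) (z : F) (s : lieAlg ρ) : 0 ≤ dmoment μ z s (inclI ρ s) := by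
  obtain ⟨L, -, h⟩ := dmoment_eq hext hμ z
  have hI : L (inclI ρ s) = Complex.I • L (incl ρ s) := by rw [← map_smul]; rfl
  rw [h, hI]
  by_cases h0 : L (incl ρ s) = 0
  · rw [h0]
    have := (Ω z).toAlternatingMap.map_coord_zero (m := ![(0 : E), Complex.I • (0 : E)]) 0 rfl
    exact this.ge
  · exact (hΩ.pos z _ h0).le

/-- If the derivative of `t ↦ ⟨μ(exp(its) z), s⟩` vanishes at `0`, then so does the vector field
generated by `s` at `z`, because the Kähler metric is definite, and the complex one-parameter group
of `s` fixes `z`. -/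
theorem smul_eq_of_dmoment_eq_zero [T2Space F] [IsManifold 𝓘(ℂ, E) ω F]
    (hext : IsHolomorphicExtension ρ E F) (hΩ : IsKaehlerForm Ω)
    (hμ : IsMomentMap ρ Ω μ) {z : F} {s : lieAlg ρ} (h0 : dmoment μ z s (inclI ρ s) = 0) (ζ : ℂ) :
    expG ρ (ζ • incl ρ s) • z = z := by
  obtain ⟨L, hL, h⟩ := dmoment_eq hext hμ z
  have hI : L (inclI ρ s) = Complex.I • L (incl ρ s) := by rw [← map_smul]; rfl
  have hX : L (incl ρ s) = 0 := by
    by_contra hne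
    have := hΩ.pos z _ hne
    rw [h, hI] at h0
    exact this.ne' h0
  have hL' : ∀ a, a = 0 → HasMFDerivAt 𝓘(ℂ, complexLieAlg ρ) 𝓘(ℂ, E) (fun a => expG ρ a • z) a
      L := by
    rintro _ rfl; exact hL
  let γ : ℂ → F := fun ζ => expG ρ (ζ • incl ρ s) • z
  have hγ0 : HasMFDerivAt 𝓘(ℂ, ℂ) 𝓘(ℂ, E) γ 0 (0 : ℂ →L[ℂ] E) := by
    have h1 := ((ContinuousLinearMap.id ℂ ℂ).smulRight (incl ρ s)).hasFDerivAt (x := (0 : ℂ))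
    have h2 := HasMFDerivAt.comp (I := 𝓘(ℂ, ℂ)) (I' := 𝓘(ℂ, complexLieAlg ρ)) (I'' := 𝓘(ℂ, E))
      (0 : ℂ) (g := fun a => expG ρ a • z)
      (f := (ContinuousLinearMap.id ℂ ℂ).smulRight (incl ρ s)) (g' := L)
      (hL' _ (by simp)) h1.hasMFDerivAt
    refine HasMFDerivAt.congr_mfderiv h2 (ContinuousLinearMap.ext fun (v : ℂ) => ?_)
    change L (v • incl ρ s) = (0 : E)
    rw [map_smul, hX, smul_zero]
  have hγ0' : ∀ w, w = 0 → HasMFDerivAt 𝓘(ℂ, ℂ) 𝓘(ℂ, E) γ w (0 : ℂ →L[ℂ] E) := by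
    rintro _ rfl; exact hγ0
  have hγ : ∀ ζ, HasMFDerivAt 𝓘(ℂ, ℂ) 𝓘(ℂ, E) γ ζ (0 : ℂ →L[ℂ] E) := by
    intro ζ
    have h1 : HasFDerivAt (fun w : ℂ => w - ζ) (ContinuousLinearMap.id ℂ ℂ) ζ :=
      (hasFDerivAt_id ζ).sub_const ζ
    have h2 := HasMFDerivAt.comp (I := 𝓘(ℂ, ℂ)) (I' := 𝓘(ℂ, ℂ)) (I'' := 𝓘(ℂ, E))
      ζ (g := γ) (f := fun w : ℂ => w - ζ) (g' := (0 : ℂ →L[ℂ] E))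
      (hγ0' _ (by simp)) h1.hasMFDerivAt
    have h3 := ((hext.mdiff_smul (expG ρ (ζ • incl ρ s))).mdifferentiable (by simp)
      (γ (ζ - ζ))).hasMFDerivAt
    have h4 := HasMFDerivAt.comp ζ h3 h2
    have h5 : ((fun x : F => expG ρ (ζ • incl ρ s) • x) ∘ γ ∘ fun w : ℂ => w - ζ) = γ := by
      ext1 w
      simp only [Function.comp_apply, γ]
      rw [smul_smul, ← expG_add_complex, add_sub_cancel]
    rw [h5] at h4
    exact HasMFDerivAt.congr_mfderiv h4 (ContinuousLinearMap.ext fun (v : ℂ) =>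
      map_zero (mfderiv 𝓘(ℂ, E) 𝓘(ℂ, E) (fun x : F => expG ρ (ζ • incl ρ s) • x) (γ (ζ - ζ))))
  have := eq_of_hasMFDerivAt_zero hγ ζ 0
  simpa [γ, expG_zero] using this

end Orbit

/-! ### Monotonicity of the weights and uniqueness of the zero orbit -/

section Weights

variable {W : Type*} [NormedAddCommGroup W] [InnerProductSpace ℂ W] [CompleteSpace W]
  [FiniteDimensional ℂ W]
  {K : Type*} [Group K] [TopologicalSpace K] [CompactSpace K] {ρ : K →ₜ* unitary (W →L[ℂ] W)}
  {E : Type*} [NormedAddCommGroup E] [NormedSpace ℂ E]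
  {F : Type*} [TopologicalSpace F] [ChartedSpace E F]
  [MulAction K F] [MulAction (complexification ρ) F]
  {μ : F → Module.Dual ℝ (lieAlg ρ)} {Ω : TwoForm E F}

theorem weightAt_eq (x : F) (s : lieAlg ρ) (t : ℝ) :
    weightAt μ x s t = μ (expG ρ (t • inclI ρ s) • x) s := by
  have h : ((t : ℂ) * Complex.I) • incl ρ s = t • inclI ρ s := mul_smul (t : ℂ) Complex.I (incl ρ s)
  rw [weightAt, h]

theorem weightAt_zero (x : F) (s : lieAlg ρ) : weightAt μ x s 0 = μ x s := by
  rw [weightAt_eq, zero_smul, expG_zero, one_smul]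

theorem hasDerivAt_weightAt (hext : IsHolomorphicExtension ρ E F) (hμ : IsMomentMap ρ Ω μ) (x : F)
    (s : lieAlg ρ) (t : ℝ) : HasDerivAt (weightAt μ x s)
      (dmoment μ (expG ρ (t • inclI ρ s) • x) s (inclI ρ s)) t :=
  (hasDerivAt_moment hext hμ x s (inclI ρ s) t).congr_of_eventuallyEq
    (Filter.Eventually.of_forall fun t => weightAt_eq x s t)

theorem monotone_weightAt (hext : IsHolomorphicExtension ρ E F) (hΩ : IsKaehlerForm Ω)
    (hμ : IsMomentMap ρ Ω μ) (x : F) (s : lieAlg ρ) : Monotone (weightAt μ x s) :=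
  monotone_of_deriv_nonneg (fun t => (hasDerivAt_weightAt hext hμ x s t).differentiableAt)
    fun t => by
      rw [(hasDerivAt_weightAt hext hμ x s t).deriv]
      exact dmoment_inclI_nonneg hext hΩ hμ _ s

theorem tendsto_weightAt (hext : IsHolomorphicExtension ρ E F) (hΩ : IsKaehlerForm Ω)
    (hμ : IsMomentMap ρ Ω μ) (x : F) (s : lieAlg ρ) :
    Filter.Tendsto (fun t : ℝ => (weightAt μ x s t : EReal)) Filter.atTop
      (𝓝 (maximalWeight μ x s)) :=
  tendsto_nhds_limUnder ⟨_, tendsto_atTop_iSup fun _ _ h =>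
    EReal.coe_le_coe_iff.2 (monotone_weightAt hext hΩ hμ x s h)⟩

theorem maximalWeight_pos_iff (hext : IsHolomorphicExtension ρ E F) (hΩ : IsKaehlerForm Ω)
    (hμ : IsMomentMap ρ Ω μ) (x : F) (s : lieAlg ρ) :
    0 < maximalWeight μ x s ↔ ∃ t, 0 < weightAt μ x s t := by
  have ht := tendsto_weightAt hext hΩ hμ x s
  constructor
  · intro h
    obtain ⟨t, ht⟩ := (ht.eventually (lt_mem_nhds h)).exists
    exact ⟨t, EReal.coe_pos.1 ht⟩
  · rintro ⟨t, h⟩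
    refine lt_of_lt_of_le (EReal.coe_pos.2 h) ?_
    exact Monotone.ge_of_tendsto (fun _ _ h =>
      EReal.coe_le_coe_iff.2 (monotone_weightAt hext hΩ hμ x s h)) ht t

theorem moment_smul (hμ : IsMomentMap ρ Ω μ) (k : K) (z : F) (s : lieAlg ρ) :
    μ (k • z) s = μ z (adj ρ k⁻¹ s) := by
  conv_lhs => rw [← adj_adj_inv k s]
  exact hμ.equivariant k z _

theorem moment_smul_eq_zero (hμ : IsMomentMap ρ Ω μ) (k : K) {z : F} (h : μ z = 0) :
    μ (k • z) = 0 := by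
  ext s
  rw [moment_smul hμ, h]
  rfl

/-- If `⟨μ, s⟩` vanishes at both ends of the geodesic `exp(its) z`, `0 ≤ t ≤ 1`, then it vanishes
along the geodesic by monotonicity, so its derivative does, and `s` acts trivially on `z`. -/
theorem smul_eq_of_moment_eq_zero [T2Space F] [IsManifold 𝓘(ℂ, E) ω F]
    (hext : IsHolomorphicExtension ρ E F) (hΩ : IsKaehlerForm Ω) (hμ : IsMomentMap ρ Ω μ) {z : F}
    {s : lieAlg ρ} (h0 : μ z s = 0) (h1 : μ (expG ρ (inclI ρ s) • z) s = 0) (ζ : ℂ) :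
    expG ρ (ζ • incl ρ s) • z = z := by
  have hm := monotone_weightAt hext hΩ hμ z s
  have hw0 : weightAt μ z s 0 = 0 := by rw [weightAt_zero, h0]
  have hw1 : weightAt μ z s 1 = 0 := by rw [weightAt_eq, one_smul, h1]
  have hconst : weightAt μ z s =ᶠ[𝓝 (1 / 2)] fun _ => 0 := by
    filter_upwards [Ioo_mem_nhds (show (0 : ℝ) < 1 / 2 by norm_num)
      (show (1 / 2 : ℝ) < 1 by norm_num)] with t ht
    exact le_antisymm (hw1 ▸ hm ht.2.le) (hw0 ▸ hm ht.1.le)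
  have hd := (hasDerivAt_weightAt hext hμ z s (1 / 2)).unique
    ((hasDerivAt_const (1 / 2 : ℝ) (0 : ℝ)).congr_of_eventuallyEq hconst)
  have hfix := smul_eq_of_dmoment_eq_zero hext hΩ hμ hd
  have e : (1 / 2 : ℝ) • inclI ρ s = (((1 / 2 : ℝ) : ℂ) * Complex.I) • incl ρ s :=
    (mul_smul ((1 / 2 : ℝ) : ℂ) Complex.I (incl ρ s)).symm
  have hz : expG ρ ((1 / 2 : ℝ) • inclI ρ s) • z = z := by
    have h2 := hfix (-(((1 / 2 : ℝ) : ℂ) * Complex.I))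
    rw [e, smul_smul, ← expG_add_complex, neg_add_cancel, zero_smul, expG_zero, one_smul, ← e] at h2
    exact h2.symm
  have h3 := hfix ζ
  rwa [hz] at h3

/-- Writing `g = k exp(iσ)`, the moment map vanishes at both ends of the geodesic `exp(itσ) y`, so
that `exp(iσ)` fixes `y`. -/
theorem orbit_eq_of_moment_eq_zero [T2Space F] [IsManifold 𝓘(ℂ, E) ω F]
    (hext : IsHolomorphicExtension ρ E F) (hΩ : IsKaehlerForm Ω) (hμ : IsMomentMap ρ Ω μ) {y : F}
    (hy : μ y = 0) (g : complexification ρ) (hgy : μ (g • y) = 0) :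
    MulAction.orbit K (g • y) = MulAction.orbit K y := by
  obtain ⟨k, σ, rfl⟩ := exists_polar g
  have h1 : μ (expG ρ (inclI ρ σ) • y) = 0 := by
    have := moment_smul_eq_zero hμ k⁻¹ hgy
    rwa [mul_smul, hext.extends_action, inv_smul_smul] at this
  have h2 := smul_eq_of_moment_eq_zero hext hΩ hμ (s := σ) (by rw [hy]; rfl) (by rw [h1]; rfl)
    Complex.I
  change expG ρ (inclI ρ σ) • y = y at h2
  rw [mul_smul, hext.extends_action, h2, MulAction.orbit_smul]

theorem zeroOrbits_subsingleton [T2Space F] [IsManifold 𝓘(ℂ, E) ω F]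
    (hext : IsHolomorphicExtension ρ E F) (hΩ : IsKaehlerForm Ω) (hμ : IsMomentMap ρ Ω μ) (x : F) :
    (zeroOrbits μ x).Subsingleton := by
  rintro O₁ ⟨⟨y₁, rfl⟩, hG₁, h₁⟩ O₂ ⟨⟨y₂, rfl⟩, hG₂, h₂⟩
  obtain ⟨g₁, hg₁⟩ := hG₁ (MulAction.mem_orbit_self y₁)
  obtain ⟨g₂, hg₂⟩ := hG₂ (MulAction.mem_orbit_self y₂)
  have hy₁ := h₁ y₁ (MulAction.mem_orbit_self y₁)
  have hy₂ := h₂ y₂ (MulAction.mem_orbit_self y₂)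
  have e : (g₁ * g₂⁻¹) • y₂ = y₁ := by
    rw [← hg₁, ← hg₂]
    simp [mul_smul]
  have := orbit_eq_of_moment_eq_zero hext hΩ hμ hy₂ (g₁ * g₂⁻¹) (by rw [e]; exact hy₁)
  rwa [e] at this

end Weights

/-! ### The Kempf–Ness function -/

theorem hasFDerivAt_integral_of_contDiff {H : Type*} [NormedAddCommGroup H] [NormedSpace ℝ H]
    [FiniteDimensional ℝ H] {h : H × ℝ → ℝ} (hh : ContDiff ℝ 1 h) (p : H) :
    HasFDerivAt (fun q => ∫ u in (0 : ℝ)..1, h (q, u))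
      (∫ u in (0 : ℝ)..1, fderiv ℝ (fun q => h (q, u)) p) p := by
  have : ProperSpace H := FiniteDimensional.proper ℝ H
  have hd : ∀ q u, HasFDerivAt (fun q => h (q, u))
      ((fderiv ℝ h (q, u)).comp (ContinuousLinearMap.inl ℝ H ℝ)) q := by
    intro q u
    have h1 := (hh.differentiable one_ne_zero (q, u)).hasFDerivAt
    exact h1.comp q (hasFDerivAt_prodMk_left q u)
  have hfd : ∀ q u, fderiv ℝ (fun q => h (q, u)) q =
      (fderiv ℝ h (q, u)).comp (ContinuousLinearMap.inl ℝ H ℝ) := fun q u => (hd q u).fderiv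
  have hcont : Continuous fun x : H × ℝ => fderiv ℝ (fun q => h (q, x.2)) x.1 := by
    simp only [hfd]
    exact (hh.continuous_fderiv one_ne_zero).clm_comp continuous_const
  obtain ⟨C, hC⟩ := ((isCompact_closedBall p 1).prod
    (isCompact_Icc (a := (0 : ℝ)) (b := 1))).exists_bound_of_continuousOn hcont.continuousOn
  refine intervalIntegral.hasFDerivAt_integral_of_dominated_of_fderiv_le
    (F := fun q u => h (q, u)) (F' := fun q u => fderiv ℝ (fun q => h (q, u)) q)
    (bound := fun _ => C) (Metric.ball_mem_nhds p one_pos) ?_ ?_ ?_ ?_ ?_ ?_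
  · refine Filter.Eventually.of_forall fun q => ?_
    exact (hh.continuous.comp (by fun_prop : Continuous fun u : ℝ => (q, u))).aestronglyMeasurable
  · exact (hh.continuous.comp (by fun_prop : Continuous fun u : ℝ => (p, u))).intervalIntegrable _ _
  · exact (hcont.comp (by fun_prop : Continuous fun u : ℝ => (p, u))).aestronglyMeasurable
  · refine Filter.Eventually.of_forall fun u hu q hq => ?_
    rw [Set.uIoc_of_le zero_le_one] at hu
    exact hC (q, u) ⟨Metric.ball_subset_closedBall hq, hu.1.le, hu.2⟩
  · exact intervalIntegrable_const
  · refine Filter.Eventually.of_forall fun u hu q hq => ?_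
    exact (hd q u).differentiableAt.hasFDerivAt

/-- A function `Φ(a, s)`, linear in `s`, is integrated along the rays `u ↦ (u I(σ), σ)`. If the
variation of the integrand in a direction `η` is the derivative of `u ↦ Φ(u I(σ), b(u))` with
`b(0) = 0`, then the variation of the integral is the boundary term `Φ(I(σ), b(1))`. -/
theorem hasFDerivAt_integral_ray {V S : Type*} [NormedAddCommGroup V] [NormedSpace ℝ V]
    [NormedAddCommGroup S] [NormedSpace ℝ S] [FiniteDimensional ℝ S] {Φ : V × S → ℝ}
    (hΦ : ContDiff ℝ 1 Φ) (hlin : ∀ a, ∃ ℓ : S →L[ℝ] ℝ, ∀ s, Φ (a, s) = ℓ s) (I : S →L[ℝ] V)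
    (σ : S) : ∃ D : S →L[ℝ] ℝ,
      HasFDerivAt (fun σ => ∫ u in (0 : ℝ)..1, Φ (u • I σ, σ)) D σ ∧
      ∀ (η : S) (b b' : ℝ → S), (∀ u, HasDerivAt b (b' u) u) → b 0 = 0 →
        (∀ u : ℝ, fderiv ℝ (fun a => Φ (a, σ)) (u • I σ) (u • I η) + Φ (u • I σ, η) =
          fderiv ℝ (fun a => Φ (a, b u)) (u • I σ) (I σ) + Φ (u • I σ, b' u)) →
        D η = Φ (I σ, b 1) := by
  have hΦd : Differentiable ℝ Φ := hΦ.differentiable one_ne_zero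
  have hpart : ∀ (a a' : V) (s s' : S), fderiv ℝ Φ (a, s) (a', s') =
      fderiv ℝ (fun a => Φ (a, s)) a a' + Φ (a, s') := by
    intro a a' s s'
    obtain ⟨ℓ, hℓ⟩ := hlin a
    have h := (hΦd (a, s)).hasFDerivAt
    have h1 : HasFDerivAt (fun a => Φ (a, s))
        ((fderiv ℝ Φ (a, s)).comp (ContinuousLinearMap.inl ℝ V S)) a :=
      HasFDerivAt.comp (f := fun a => (a, s)) a h (hasFDerivAt_prodMk_left a s)
    have h2 : HasFDerivAt (fun s => Φ (a, s))
        ((fderiv ℝ Φ (a, s)).comp (ContinuousLinearMap.inr ℝ V S)) s :=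
      HasFDerivAt.comp (f := fun s => (a, s)) s h (hasFDerivAt_prodMk_right a s)
    have h3 : HasFDerivAt (fun s => Φ (a, s)) ℓ s := by
      rw [funext hℓ]; exact ℓ.hasFDerivAt
    have e : (a', s') = (a', 0) + ((0 : V), s') := by simp
    rw [h1.fderiv, hℓ, ← h2.unique h3, e, map_add]
    simp
  have hh : ContDiff ℝ 1 fun p : S × ℝ => Φ (p.2 • I p.1, p.1) := by fun_prop
  have hvar : ∀ u : ℝ, HasFDerivAt (fun q : S => Φ (u • I q, q))
      ((fderiv ℝ Φ (u • I σ, σ)).comp ((u • I).prod (ContinuousLinearMap.id ℝ S))) σ := fun u =>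
    HasFDerivAt.comp (f := fun q : S => (u • I q, q)) σ (hΦd (u • I σ, σ)).hasFDerivAt
      ((I.hasFDerivAt.const_smul u).prodMk (hasFDerivAt_id σ))
  have hcont : Continuous fun u : ℝ => fderiv ℝ (fun q : S => Φ (u • I q, q)) σ := by
    have h1 : Continuous fun u : ℝ => (u • I σ, σ) := by fun_prop
    have h2 : (fun u : ℝ => (u • I).prod (ContinuousLinearMap.id ℝ S)) = fun u =>
        u • I.prod (0 : S →L[ℝ] S) + (0 : S →L[ℝ] V).prod (ContinuousLinearMap.id ℝ S) := by
      ext1 u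
      ext v <;> simp
    have h3 : Continuous fun u : ℝ => (u • I).prod (ContinuousLinearMap.id ℝ S) := by
      rw [h2]; fun_prop
    simp only [fun u => (hvar u).fderiv]
    exact ((hΦ.continuous_fderiv one_ne_zero).comp h1).clm_comp h3
  refine ⟨_, hasFDerivAt_integral_of_contDiff hh σ, fun η b b' hb hb0 hc => ?_⟩
  rw [ContinuousLinearMap.intervalIntegral_apply (hcont.intervalIntegrable 0 1)]
  have hderiv : ∀ u : ℝ, HasDerivAt (fun u => Φ (u • I σ, b u))
      (fderiv ℝ (fun q : S => Φ (u • I q, q)) σ η) u := by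
    intro u
    have h1 : HasDerivAt (fun u : ℝ => u • I σ) (I σ) u := by
      simpa using (hasDerivAt_id u).smul_const (I σ)
    have h2 := HasFDerivAt.comp_hasDerivAt (f := fun u => (u • I σ, b u)) u
      (hΦd (u • I σ, b u)).hasFDerivAt (h1.prodMk (hb u))
    refine h2.congr_deriv ?_
    rw [hpart, ← hc, ← hpart, (hvar u).fderiv]
    rfl
  have h5 := intervalIntegral.integral_eq_sub_of_hasDerivAt (a := (0 : ℝ)) (b := 1)
    (fun u _ => hderiv u) ((hcont.clm_apply continuous_const).intervalIntegrable 0 1)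
  obtain ⟨ℓ, hℓ⟩ := hlin 0
  refine h5.trans ?_
  rw [hb0, zero_smul, one_smul, hℓ, map_zero, sub_zero]

section KempfNessFunction

variable {W : Type*} [NormedAddCommGroup W] [InnerProductSpace ℂ W] [CompleteSpace W]
  [FiniteDimensional ℂ W]
  {K : Type*} [Group K] [TopologicalSpace K] [CompactSpace K] {ρ : K →ₜ* unitary (W →L[ℂ] W)}
  {E : Type*} [NormedAddCommGroup E] [NormedSpace ℂ E]
  {F : Type*} [TopologicalSpace F] [ChartedSpace E F]
  [MulAction K F] [MulAction (complexification ρ) F]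
  {μ : F → Module.Dual ℝ (lieAlg ρ)} {Ω : TwoForm E F}

theorem contDiff_moment_pairing (hext : IsHolomorphicExtension ρ E F) (hμ : IsMomentMap ρ Ω μ)
    (x : F) : ContDiff ℝ 1 fun p : complexLieAlg ρ × lieAlg ρ => μ (expG ρ p.1 • x) p.2 := by
  let b := Module.finBasis ℝ (lieAlg ρ)
  have h : (fun p : complexLieAlg ρ × lieAlg ρ => μ (expG ρ p.1 • x) p.2) =
      fun p => ∑ i, b.coord i p.2 * μ (expG ρ p.1 • x) (b i) := by
    ext1 p
    conv_lhs => rw [← b.sum_repr p.2, map_sum]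
    simp
  rw [h]
  refine ContDiff.sum fun i _ => ContDiff.mul ?_ ?_
  · exact ((b.coord i).toContinuousLinearMap.contDiff).comp contDiff_snd
  · have h1 := contDiff_moment hext hμ x (b i)
    have h2 : ContDiff ℝ 1 fun p : complexLieAlg ρ × lieAlg ρ =>
      ((p.1, 0, 0) : complexLieAlg ρ × complexLieAlg ρ × complexLieAlg ρ) := by fun_prop
    have := h1.comp h2
    simpa [Function.comp_def, expG_zero] using this

/-- The Kempf–Ness function of `x`, in the coordinates `σ ↦ K exp(iσ)` of the symmetric space
`K \ G`: the integral of the moment map along the geodesic `exp(iuσ)`, `0 ≤ u ≤ 1`. -/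
def kempfNess (μ : F → Module.Dual ℝ (lieAlg ρ)) (x : F) (σ : lieAlg ρ) : ℝ :=
  ∫ u in (0 : ℝ)..1, μ (expG ρ (u • inclI ρ σ) • x) σ

/-- The differential of the Kempf–Ness function at `σ` is given by the moment map at `exp(iσ) x`.
This is the closedness of the one-form on `G` defined by the moment map: the variation of the
integrand is the derivative of `u ↦ ⟨μ(exp(iuσ) x), Im β(u)⟩`. -/
theorem hasFDerivAt_kempfNess (hext : IsHolomorphicExtension ρ E F) (hΩ : IsKaehlerForm Ω)
    (hμ : IsMomentMap ρ Ω μ) (x : F) (σ : lieAlg ρ) :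
    ∃ D : lieAlg ρ →L[ℝ] ℝ, HasFDerivAt (kempfNess μ x) D σ ∧
      ∀ η, D η = μ (expG ρ (inclI ρ σ) • x) (imBeta ρ σ η) := by
  obtain ⟨D, hD, hDη⟩ := hasFDerivAt_integral_ray
    (Φ := fun p : complexLieAlg ρ × lieAlg ρ => μ (expG ρ p.1 • x) p.2)
    (contDiff_moment_pairing hext hμ x)
    (fun a => ⟨(μ (expG ρ a • x)).toContinuousLinearMap, fun s => rfl⟩)
    (inclI ρ).toContinuousLinearMap σ
  simp only [LinearMap.coe_toContinuousLinearMap'] at hD hDη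
  refine ⟨D, hD, fun η => hDη η (fun u => imP ρ (beta σ η u))
    (fun u => η + ⟨_, bracket_mem σ (reP ρ (beta σ η u))⟩) (hasDerivAt_imP_beta σ η)
    (by simp [beta]) fun u => ?_⟩
  set y := expG ρ (u • inclI ρ σ) • x with hy
  set b := beta σ η u with hb
  have h1 : HasDerivAt (fun u : ℝ => u • inclI ρ σ) (inclI ρ σ) u := by
    simpa using (hasDerivAt_id u).smul_const (inclI ρ σ)
  have h3 : fderiv ℝ (fun a : complexLieAlg ρ => μ (expG ρ a • x) (imP ρ b)) (u • inclI ρ σ)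
      (inclI ρ σ) = dmoment μ y (imP ρ b) (inclI ρ σ) := by
    have e1 := (differentiable_moment hext hμ x (imP ρ b) (u • inclI ρ σ)).hasFDerivAt
      |>.comp_hasDerivAt u h1
    exact e1.unique (hasDerivAt_moment hext hμ x (imP ρ b) (inclI ρ σ) u)
  have h4 : dmoment μ y σ b = μ y ⟨_, bracket_mem σ (reP ρ b)⟩ +
      dmoment μ y (imP ρ b) (inclI ρ σ) := by
    conv_lhs => rw [← reP_add_imP b]
    rw [map_add, dmoment_incl hext hμ, dmoment_inclI_symm hext hΩ hμ]
  rw [h3, fderiv_moment_inclI hext hμ, ← hb, ← hy, h4, map_add]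
  ring

theorem continuous_kempfNess (hext : IsHolomorphicExtension ρ E F) (hΩ : IsKaehlerForm Ω)
    (hμ : IsMomentMap ρ Ω μ) (x : F) : Continuous (kempfNess μ x) :=
  continuous_iff_continuousAt.2 fun σ =>
    (hasFDerivAt_kempfNess hext hΩ hμ x σ).choose_spec.1.continuousAt

/-- In the coordinates of the polar decomposition, the Kempf–Ness function has derivative
`⟨μ(exp(its) h x), s⟩` along the curve `exp(its) h`. -/
theorem exists_kempfNess_curve (hext : IsHolomorphicExtension ρ E F) (hΩ : IsKaehlerForm Ω)
    (hμ : IsMomentMap ρ Ω μ) (x : F) (h : complexification ρ) (s : lieAlg ρ) :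
    ∃ (k : ℝ → K) (σ : ℝ → lieAlg ρ), ∀ t : ℝ,
      expG ρ (t • inclI ρ s) * h = toComplexification ρ (k t) * expG ρ (inclI ρ (σ t)) ∧
      HasDerivAt (fun t => kempfNess μ x (σ t)) (weightAt μ (h • x) s t) t := by
  obtain ⟨k, σ, σ', hσ⟩ := exists_polar_curve h s
  refine ⟨k, σ, fun t => ⟨(hσ t).1, ?_⟩⟩
  obtain ⟨D, hD, hDη⟩ := hasFDerivAt_kempfNess hext hΩ hμ x (σ t)
  refine (hD.comp_hasDerivAt t (hσ t).2.1).congr_deriv ?_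
  rw [hDη, (hσ t).2.2, ← moment_smul hμ, weightAt_eq, smul_smul, (hσ t).1, mul_smul,
    hext.extends_action]

/-- In the radial direction, the logarithmic derivative of `exp(irs)` is `is`. -/
theorem imBeta_smul_self (s : lieAlg ρ) (r : ℝ) : imBeta ρ (r • s) s = s := by
  have h : ∀ v : ℝ, conjI (r • s) v (inclI ρ s) = inclI ρ s := by
    intro v
    ext1
    set p : W →L[ℂ] W := ↑(inclI ρ s) with hp
    have e : (v • (inclI ρ (r • s) : W →L[ℂ] W)) = (v * r) • p := by
      rw [map_smul, coe_real_smul, smul_smul]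
    rw [coe_conjI, e, ← hp]
    have hc : Commute (NormedSpace.exp ((v * r) • p)) p :=
      ((Commute.refl p).smul_left (v * r)).exp_left
    rw [hc.eq, mul_assoc, exp_mul_exp_neg, mul_one]
  simp [imBeta, beta, h]

theorem hasDerivAt_kempfNess_smul (hext : IsHolomorphicExtension ρ E F) (hΩ : IsKaehlerForm Ω)
    (hμ : IsMomentMap ρ Ω μ) (x : F) (s : lieAlg ρ) (r : ℝ) :
    HasDerivAt (fun r : ℝ => kempfNess μ x (r • s)) (weightAt μ x s r) r := by
  obtain ⟨D, hD, hDη⟩ := hasFDerivAt_kempfNess hext hΩ hμ x (r • s)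
  have h1 : HasDerivAt (fun r : ℝ => r • s) s r := by
    simpa using (hasDerivAt_id r).smul_const s
  refine (hD.comp_hasDerivAt r h1).congr_deriv ?_
  rw [hDη, imBeta_smul_self, weightAt_eq, map_smul]

/-- The Kempf–Ness function of a stable point grows at least linearly: by compactness of the unit
sphere of `𝔨`, its slopes along all rays exceed a common positive constant from some time on. -/
theorem exists_kempfNess_lower_bound (hext : IsHolomorphicExtension ρ E F) (hΩ : IsKaehlerForm Ω)
    (hμ : IsMomentMap ρ Ω μ) {x : F} (hx : AnalyticallyStable μ x) :
    ∃ δ > 0, ∃ C : ℝ, ∀ σ : lieAlg ρ, δ * ‖σ‖ - C ≤ kempfNess μ x σ := by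
  have : ProperSpace (lieAlg ρ) := FiniteDimensional.proper ℝ _
  have hwc : ∀ t : ℝ, Continuous fun s : lieAlg ρ => weightAt μ x s t := by
    intro t
    simp only [weightAt_eq]
    have h1 := (contDiff_moment_pairing hext hμ x).continuous
    have h2 : Continuous fun s : lieAlg ρ => (t • inclI ρ s, s) :=
      (((inclI ρ).toContinuousLinearMap.continuous).const_smul t).prodMk continuous_id
    exact h1.comp h2
  have hS : IsCompact (Metric.sphere (0 : lieAlg ρ) 1) := isCompact_sphere 0 1
  obtain ⟨N, hN⟩ := hS.elim_directed_cover (fun n : ℕ => {s : lieAlg ρ | 0 < weightAt μ x s n})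
    (fun n => isOpen_lt continuous_const (hwc n))
    (by
      intro s hs
      have hs0 : s ≠ 0 := by rintro rfl; simp at hs
      obtain ⟨t, ht⟩ := (maximalWeight_pos_iff hext hΩ hμ x s).1 (hx s hs0)
      obtain ⟨n, hn⟩ := exists_nat_ge t
      exact Set.mem_iUnion.2 ⟨n, ht.trans_le (monotone_weightAt hext hΩ hμ x s hn)⟩)
    (directed_of_isDirected_le fun m n hmn s hs =>
      lt_of_lt_of_le hs (monotone_weightAt hext hΩ hμ x s (Nat.cast_le.2 hmn)))
  obtain ⟨δ, hδ, hδS⟩ : ∃ δ > 0, ∀ s ∈ Metric.sphere (0 : lieAlg ρ) 1, δ ≤ weightAt μ x s N := by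
    rcases (Metric.sphere (0 : lieAlg ρ) 1).eq_empty_or_nonempty with he | hne
    · exact ⟨1, one_pos, by simp [he]⟩
    · obtain ⟨s, hs, hmin⟩ := hS.exists_isMinOn hne (hwc N).continuousOn
      exact ⟨weightAt μ x s N, hN hs, fun s' hs' => hmin hs'⟩
  have hc := continuous_kempfNess hext hΩ hμ x
  obtain ⟨C, hC⟩ := (isCompact_closedBall (0 : lieAlg ρ) N).exists_bound_of_continuousOn
    hc.continuousOn
  refine ⟨δ, hδ, C + δ * N, fun σ => ?_⟩
  have hCb : ∀ σ : lieAlg ρ, ‖σ‖ ≤ N → -C ≤ kempfNess μ x σ := fun σ hσ =>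
    (abs_le.1 (hC σ (by simpa using hσ))).1
  rcases le_total ‖σ‖ N with hle | hge
  · have := hCb σ hle
    have := mul_le_mul_of_nonneg_left hle hδ.le
    linarith
  · rcases eq_or_ne σ 0 with rfl | hσ
    · have := hCb 0 (by simp)
      have : 0 ≤ δ * N := by positivity
      simp only [norm_zero, mul_zero]; linarith
    · have hσn : ‖σ‖ ≠ 0 := norm_ne_zero_iff.2 hσ
      set s := ‖σ‖⁻¹ • σ with hs
      have hs1 : ‖s‖ = 1 := by rw [hs, norm_smul, norm_inv, norm_norm, inv_mul_cancel₀ hσn]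
      have hsσ : ‖σ‖ • s = σ := by rw [hs, smul_inv_smul₀ hσn]
      have hd := hasDerivAt_kempfNess_smul hext hΩ hμ x s
      have hmv := Convex.mul_sub_le_image_sub_of_le_deriv (convex_Ici (N : ℝ))
        (f := fun r : ℝ => kempfNess μ x (r • s))
        (fun r _ => (hd r).continuousAt.continuousWithinAt)
        (fun r _ => (hd r).differentiableAt.differentiableWithinAt) (C := δ)
        (fun r hr => by
          rw [(hd r).deriv]
          rw [interior_Ici] at hr
          exact (hδS s (by simp [hs1])).trans (monotone_weightAt hext hΩ hμ x s (le_of_lt hr)))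
        N (Set.mem_Ici.2 le_rfl) ‖σ‖ hge hge
      have h1 := hCb ((N : ℝ) • s) (by rw [norm_smul, hs1]; simp)
      simp only [hsσ] at hmv
      linarith

/-- A stable point has a zero of the moment map in its `G`-orbit, at a minimum of the Kempf–Ness
function. -/
theorem exists_moment_eq_zero (hext : IsHolomorphicExtension ρ E F) (hΩ : IsKaehlerForm Ω)
    (hμ : IsMomentMap ρ Ω μ) {x : F} (hx : AnalyticallyStable μ x) :
    ∃ g : complexification ρ, μ (g • x) = 0 := by
  have : ProperSpace (lieAlg ρ) := FiniteDimensional.proper ℝ _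
  obtain ⟨δ, hδ, C, hC⟩ := exists_kempfNess_lower_bound hext hΩ hμ hx
  have htend : Filter.Tendsto (kempfNess μ x) (Filter.cocompact (lieAlg ρ)) Filter.atTop := by
    refine Filter.tendsto_atTop_mono hC ?_
    exact Filter.tendsto_atTop_add_const_right _ (-C)
      ((tendsto_norm_cocompact_atTop (E := lieAlg ρ)).const_mul_atTop hδ)
  obtain ⟨σ₀, hσ₀⟩ := (continuous_kempfNess hext hΩ hμ x).exists_forall_le htend
  refine ⟨expG ρ (inclI ρ σ₀), ?_⟩
  ext s
  obtain ⟨k, σ, hσ⟩ := exists_kempfNess_curve hext hΩ hμ x (expG ρ (inclI ρ σ₀)) s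
  have h0 : σ 0 = σ₀ := by
    have h1 := (hσ 0).1
    rw [zero_smul, expG_zero, one_mul] at h1
    have h2 : (NormedSpace.exp (inclI ρ σ₀ : W →L[ℂ] W)) = (toGL ρ (k 0) : (W →L[ℂ] W)ˣ) *
        NormedSpace.exp (inclI ρ (σ 0) : W →L[ℂ] W) :=
      congrArg (fun x : complexification ρ => (((x : (W →L[ℂ] W)ˣ)) : W →L[ℂ] W)) h1
    have h3 := star_mul_self_polar (k 0) (σ 0)
    rw [← h2, NormedSpace.star_exp, (isSelfAdjoint_inclI σ₀).star_eq, exp_mul_exp_self,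
      exp_mul_exp_self] at h3
    have h4 := exp_injOn_isSelfAdjoint (isSelfAdjoint_real_smul (isSelfAdjoint_inclI σ₀) 2)
      (isSelfAdjoint_real_smul (isSelfAdjoint_inclI (σ 0)) 2) h3
    have h5 : inclI ρ σ₀ = inclI ρ (σ 0) := by
      ext1; exact smul_right_injective _ (two_ne_zero (α := ℝ)) h4
    rw [← imP_inclI (σ 0), ← h5, imP_inclI]
  have hmin : IsLocalMin (fun t => kempfNess μ x (σ t)) 0 :=
    Filter.Eventually.of_forall fun t => by
      simp only [h0]; exact hσ₀ (σ t)
  have h6 := hmin.hasDerivAt_eq_zero (hσ 0).2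
  rwa [weightAt_zero] at h6

end KempfNessFunction

/-! ### Stability along an orbit -/

section Stability

variable {W : Type*} [NormedAddCommGroup W] [InnerProductSpace ℂ W] [CompleteSpace W]
  [FiniteDimensional ℂ W]
  {K : Type*} [Group K] [TopologicalSpace K] [CompactSpace K] {ρ : K →ₜ* unitary (W →L[ℂ] W)}
  {E : Type*} [NormedAddCommGroup E] [NormedSpace ℂ E]
  {F : Type*} [TopologicalSpace F] [ChartedSpace E F]
  [MulAction K F] [MulAction (complexification ρ) F]
  {μ : F → Module.Dual ℝ (lieAlg ρ)} {Ω : TwoForm E F}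

/-- A nonzero `s ∈ 𝔨` generates an unbounded half-line `exp(its)`, `t ≥ 0`, in `GL(W)`: otherwise
`z ↦ exp(zs)` is a bounded entire function. -/
theorem eq_zero_of_bounded_exp (s : lieAlg ρ) (M : ℝ)
    (h : ∀ t : ℝ, 0 ≤ t → ‖NormedSpace.exp (t • (inclI ρ s : W →L[ℂ] W))‖ ≤ M ∧
      ‖NormedSpace.exp (-(t • (inclI ρ s : W →L[ℂ] W)))‖ ≤ M) : s = 0 := by
  have hM : ∀ t : ℝ, ‖NormedSpace.exp (t • (inclI ρ s : W →L[ℂ] W))‖ ≤ M := by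
    intro t
    rcases le_total 0 t with ht | ht
    · exact (h t ht).1
    · have := (h (-t) (by linarith)).2
      rwa [neg_smul, neg_neg] at this
  let f : ℂ → W →L[ℂ] W := fun z => NormedSpace.exp (z • (s : W →L[ℂ] W))
  have hd : ∀ z, HasDerivAt f (NormedSpace.exp (z • (s : W →L[ℂ] W)) * s) z := fun z =>
    hasDerivAt_exp_smul_const (𝕂 := ℂ) (s : W →L[ℂ] W) z
  have hb : Bornology.IsBounded (Set.range f) := by
    refine isBounded_iff_forall_norm_le.2 ⟨M, ?_⟩
    rintro _ ⟨z, rfl⟩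
    have e : z • (s : W →L[ℂ] W) = z.re • (s : W →L[ℂ] W) + z.im • (inclI ρ s : W →L[ℂ] W) := by
      conv_lhs => rw [← Complex.re_add_im z]
      rw [add_smul, mul_smul]; rfl
    have hc : Commute (z.re • (s : W →L[ℂ] W)) (z.im • (inclI ρ s : W →L[ℂ] W)) :=
      (((Commute.refl (s : W →L[ℂ] W)).smul_right Complex.I).smul_left _).smul_right _
    obtain ⟨k, hk⟩ := s.2 z.re
    have hk' : ‖NormedSpace.exp (z.re • (s : W →L[ℂ] W))‖ ≤ 1 := by
      have := norm_toGL_le ρ k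
      rwa [hk] at this
    change ‖NormedSpace.exp (z • (s : W →L[ℂ] W))‖ ≤ M
    rw [e, exp_add_eq_mul_of_commute hc]
    calc _ ≤ _ := norm_mul_le _ _
      _ ≤ 1 * M := mul_le_mul hk' (hM z.im) (norm_nonneg _) zero_le_one
      _ = M := one_mul M
  have hconst : ∀ z, f z = f 0 := fun z =>
    Differentiable.apply_eq_apply_of_bounded (fun z => (hd z).differentiableAt) hb z 0
  have h0 := (hd 0).unique ((hasDerivAt_const (0 : ℂ) (f 0)).congr_of_eventuallyEq
    (Filter.Eventually.of_forall hconst))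
  ext1
  simpa using h0

/-- Stability is invariant under `G`. If a weight of `h x` were nonpositive in the direction
`s ≠ 0`, the Kempf–Ness function of `x` would be bounded above along `exp(its) h`, `t ≥ 0`; by its
growth the Hermitian parts of these elements would stay bounded, which they do not. -/
theorem AnalyticallyStable.smul (hext : IsHolomorphicExtension ρ E F) (hΩ : IsKaehlerForm Ω)
    (hμ : IsMomentMap ρ Ω μ) {x : F} (hx : AnalyticallyStable μ x) (h : complexification ρ) :
    AnalyticallyStable μ (h • x) := by
  intro s hs
  by_contra hneg
  have hw : ∀ t, weightAt μ (h • x) s t ≤ 0 := fun t => by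
    by_contra ht
    exact hneg ((maximalWeight_pos_iff hext hΩ hμ _ s).2 ⟨t, not_le.1 ht⟩)
  obtain ⟨k, σ, hσ⟩ := exists_kempfNess_curve hext hΩ hμ x h s
  have hanti : Antitone fun t => kempfNess μ x (σ t) :=
    antitone_of_deriv_nonpos (fun t => (hσ t).2.differentiableAt) fun t => by
      rw [(hσ t).2.deriv]; exact hw t
  obtain ⟨δ, hδ, C, hC⟩ := exists_kempfNess_lower_bound hext hΩ hμ hx
  set R := (kempfNess μ x (σ 0) + C) / δ with hR
  have hσR : ∀ t, 0 ≤ t → ‖σ t‖ ≤ R := by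
    intro t ht
    rw [hR, le_div_iff₀ hδ]
    have h1 : kempfNess μ x (σ t) ≤ kempfNess μ x (σ 0) := hanti ht
    have h2 := hC (σ t)
    linarith
  have : ProperSpace (lieAlg ρ) := FiniteDimensional.proper ℝ _
  have hIc : Continuous fun s : lieAlg ρ => (inclI ρ s : W →L[ℂ] W) :=
    continuous_subtype_val.comp (inclI ρ).toContinuousLinearMap.continuous
  have hexp := (contDiff_exp (W := W)).continuous
  obtain ⟨A, hA⟩ := (isCompact_closedBall (0 : lieAlg ρ) R).exists_bound_of_continuousOn
    (hexp.comp hIc).continuousOn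
  obtain ⟨B, hB⟩ := (isCompact_closedBall (0 : lieAlg ρ) R).exists_bound_of_continuousOn
    (hexp.comp hIc.neg).continuousOn
  let hu : (W →L[ℂ] W)ˣ := h
  have hnorm : ∀ k : K, ‖((toGL ρ k : (W →L[ℂ] W)ˣ) : W →L[ℂ] W)‖ ≤ 1 := norm_toGL_le ρ
  have hnorm' : ∀ k : K, ‖(((toGL ρ k)⁻¹ : (W →L[ℂ] W)ˣ) : W →L[ℂ] W)‖ ≤ 1 := fun k => by
    rw [← map_inv]; exact hnorm k⁻¹
  refine hs (eq_zero_of_bounded_exp s (max (A * ‖((hu⁻¹ : (W →L[ℂ] W)ˣ) : W →L[ℂ] W)‖)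
    (‖(hu : W →L[ℂ] W)‖ * B)) fun t ht => ?_)
  have hmem : σ t ∈ Metric.closedBall (0 : lieAlg ρ) R := by simpa using hσR t ht
  have hAt : ‖NormedSpace.exp (inclI ρ (σ t) : W →L[ℂ] W)‖ ≤ A := hA _ hmem
  have hBt : ‖NormedSpace.exp (-(inclI ρ (σ t) : W →L[ℂ] W))‖ ≤ B := hB _ hmem
  have e : expUnit (t • (inclI ρ s : W →L[ℂ] W)) * hu =
      toGL ρ (k t) * expUnit (inclI ρ (σ t) : W →L[ℂ] W) := congrArg Subtype.val (hσ t).1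
  constructor
  · refine le_trans ?_ (le_max_left _ _)
    have e1 : NormedSpace.exp (t • (inclI ρ s : W →L[ℂ] W)) =
        (toGL ρ (k t) : (W →L[ℂ] W)ˣ) * NormedSpace.exp (inclI ρ (σ t) : W →L[ℂ] W) *
          (hu⁻¹ : (W →L[ℂ] W)ˣ) :=
      congrArg (fun x : (W →L[ℂ] W)ˣ => (x : W →L[ℂ] W)) (eq_mul_inv_of_mul_eq e)
    rw [e1]
    refine (norm_mul_le _ _).trans (mul_le_mul_of_nonneg_right ?_ (norm_nonneg _))
    refine (norm_mul_le _ _).trans ?_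
    have := mul_le_mul (hnorm (k t)) hAt (norm_nonneg _) zero_le_one
    rwa [one_mul] at this
  · refine le_trans ?_ (le_max_right _ _)
    have e1 : NormedSpace.exp (-(t • (inclI ρ s : W →L[ℂ] W))) =
        hu * (NormedSpace.exp (-(inclI ρ (σ t) : W →L[ℂ] W)) *
          ((toGL ρ (k t))⁻¹ : (W →L[ℂ] W)ˣ)) := by
      have e2 : (expUnit (t • (inclI ρ s : W →L[ℂ] W)))⁻¹ =
          hu * ((expUnit (inclI ρ (σ t) : W →L[ℂ] W))⁻¹ * (toGL ρ (k t))⁻¹) := by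
        rw [← mul_inv_rev, ← e, mul_inv_rev, mul_inv_cancel_left]
      exact congrArg (fun x : (W →L[ℂ] W)ˣ => (x : W →L[ℂ] W)) e2
    rw [e1]
    refine (norm_mul_le _ _).trans (mul_le_mul_of_nonneg_left ?_ (norm_nonneg _))
    refine (norm_mul_le _ _).trans ?_
    have := mul_le_mul hBt (hnorm' (k t)) (norm_nonneg _) ((norm_nonneg _).trans hBt)
    rwa [mul_one] at this

/-! ### Stabilizers -/

/-- If the real one-parameter group of `s` fixes `z`, then the vector field of `s` vanishes at `z`.
-/
theorem dmoment_eq_zero_of_smul_eq (hext : IsHolomorphicExtension ρ E F) (hμ : IsMomentMap ρ Ω μ)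
    {z : F} {s : lieAlg ρ} (h : ∀ t : ℝ, expG ρ (t • inclₗ ρ s) • z = z) :
    dmoment μ z s (inclI ρ s) = 0 := by
  obtain ⟨L, hL, hLd⟩ := dmoment_eq hext hμ z
  have hLr : ∀ a, a = 0 → HasMFDerivAt 𝓘(ℝ, complexLieAlg ρ) 𝓘(ℝ, E) (fun a => expG ρ a • z) a
      (L.restrictScalars ℝ : complexLieAlg ρ →L[ℝ] E) := by
    rintro _ rfl; exact hasMFDerivAt_restrictScalars hL
  have h1 := ((ContinuousLinearMap.id ℝ ℝ).smulRight (inclₗ ρ s)).hasFDerivAt (x := (0 : ℝ))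
  have h2 := HasMFDerivAt.comp (I := 𝓘(ℝ, ℝ)) (I' := 𝓘(ℝ, complexLieAlg ρ)) (I'' := 𝓘(ℝ, E))
    (0 : ℝ) (g := fun a => expG ρ a • z)
    (f := (ContinuousLinearMap.id ℝ ℝ).smulRight (inclₗ ρ s)) (g' := L.restrictScalars ℝ)
    (hLr _ (by simp)) h1.hasMFDerivAt
  have h3 : (fun a => expG ρ a • z) ∘ ((ContinuousLinearMap.id ℝ ℝ).smulRight (inclₗ ρ s)) =
      fun _ => z := funext h
  rw [h3] at h2
  have h4 := hasMFDerivAt_unique h2 (hasMFDerivAt_const z (0 : ℝ))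
  have h5 : L (incl ρ s) = 0 := by
    have : L ((1 : ℝ) • inclₗ ρ s) = (0 : E) := congrArg (fun T : ℝ →L[ℝ] E => T 1) h4
    rwa [one_smul] at this
  rw [hLd, h5]
  exact (Ω z).toAlternatingMap.map_coord_zero (m := ![(0 : E), L (inclI ρ s)]) 0 rfl

/-- A closed subgroup `S` of `K` whose image in `GL(W)` accumulates at `1` contains a one-parameter
group of `𝔨`: the directions of the logarithms of elements close to `1` accumulate at some `v`, and
`exp(tv)` is a limit of powers of these elements. -/
theorem exists_lieAlg_of_accumulate {S : Set K} (hS1 : (1 : K) ∈ S)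
    (hSm : ∀ a ∈ S, ∀ b ∈ S, a * b ∈ S) (hSi : ∀ a ∈ S, a⁻¹ ∈ S)
    (hSc : IsCompact S)
    (hacc : ∀ ε > 0, ∃ k ∈ S, ((toGL ρ k : (W →L[ℂ] W)ˣ) : W →L[ℂ] W) ≠ 1 ∧
      ‖((toGL ρ k : (W →L[ℂ] W)ˣ) : W →L[ℂ] W) - 1‖ < ε) :
    ∃ s : lieAlg ρ, s ≠ 0 ∧ ∀ t : ℝ, ∃ k ∈ S, toGL ρ k = expUnit (t • (s : W →L[ℂ] W)) := by
  have : ProperSpace (W →L[ℂ] W) := FiniteDimensional.proper ℝ _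
  let A : Set (W →L[ℂ] W) := (fun k : K => ((toGL ρ k : (W →L[ℂ] W)ˣ) : W →L[ℂ] W)) '' S
  have hAc : IsClosed A := by
    have hc : Continuous fun k : K => ((toGL ρ k : (W →L[ℂ] W)ˣ) : W →L[ℂ] W) :=
      continuous_subtype_val.comp ρ.continuous_toFun
    exact (hSc.image hc).isClosed
  choose k hkS hk1 hkε using fun n : ℕ => hacc (1 / ((n : ℝ) + 1)) (by positivity)
  have hklim : Filter.Tendsto (fun n => ((toGL ρ (k n) : (W →L[ℂ] W)ˣ) : W →L[ℂ] W)) Filter.atTop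
      (𝓝 1) := by
    rw [tendsto_iff_norm_sub_tendsto_zero]
    exact squeeze_zero (fun _ => norm_nonneg _) (fun n => (hkε n).le)
      tendsto_one_div_add_atTop_nhds_zero_nat
  -- logarithms of the elements `k n`
  have hD : HasStrictFDerivAt NormedSpace.exp
      ((ContinuousLinearEquiv.refl ℝ (W →L[ℂ] W) : (W →L[ℂ] W) ≃L[ℝ] (W →L[ℂ] W)) :
        (W →L[ℂ] W) →L[ℝ] (W →L[ℂ] W)) 0 :=
    hasStrictFDerivAt_exp_zero
  have hl := hD.to_localInverse.hasFDerivAt.continuousAt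
  have hr := hD.eventually_right_inverse
  set ℓ := hD.localInverse with hℓ
  have hℓ0 : ℓ (NormedSpace.exp 0) = 0 := hD.localInverse_apply_image
  rw [ContinuousAt, hℓ0, NormedSpace.exp_zero] at hl
  rw [NormedSpace.exp_zero] at hr
  let z : ℕ → W →L[ℂ] W := fun n => ℓ ((toGL ρ (k n) : (W →L[ℂ] W)ˣ) : W →L[ℂ] W)
  have hz0 : Filter.Tendsto z Filter.atTop (𝓝 0) := hl.comp hklim
  have hze : ∀ᶠ n in Filter.atTop, NormedSpace.exp (z n) =
      ((toGL ρ (k n) : (W →L[ℂ] W)ˣ) : W →L[ℂ] W) := hklim.eventually hr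
  have hzne : ∀ᶠ n in Filter.atTop, z n ≠ 0 := by
    filter_upwards [hze] with n hn h0
    rw [h0, NormedSpace.exp_zero] at hn
    exact hk1 n hn.symm
  obtain ⟨v, hv, φ, hφ, hφv⟩ : ∃ v : W →L[ℂ] W, ‖v‖ = 1 ∧ ∃ φ : ℕ → ℕ, StrictMono φ ∧
      Filter.Tendsto (fun n => ‖z (φ n)‖⁻¹ • z (φ n)) Filter.atTop (𝓝 v) := by
    have h1 : ∃ᶠ n in Filter.atTop, ‖z n‖⁻¹ • z n ∈ Metric.sphere (0 : W →L[ℂ] W) 1 :=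
      (hzne.mono fun n hn => by
        simp [norm_smul, inv_mul_cancel₀ (norm_ne_zero_iff.2 hn)]).frequently
    obtain ⟨v, hv, φ, hφ, hφv⟩ := (isCompact_sphere (0 : W →L[ℂ] W) 1).tendsto_subseq' h1
    exact ⟨v, by simpa using hv, φ, hφ, hφv⟩
  have hexp := (contDiff_exp (W := W)).continuous
  have hpos : ∀ t : ℝ, 0 ≤ t → NormedSpace.exp (t • v) ∈ A := by
    intro t ht
    let m : ℕ → ℕ := fun n => ⌊t / ‖z (φ n)‖⌋₊
    have hzφ : Filter.Tendsto (fun n => ‖z (φ n)‖) Filter.atTop (𝓝 0) := by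
      simpa using (hz0.comp hφ.tendsto_atTop).norm
    have hm : Filter.Tendsto (fun n => (m n : ℝ) * ‖z (φ n)‖) Filter.atTop (𝓝 t) := by
      have hlow : Filter.Tendsto (fun n => t - ‖z (φ n)‖) Filter.atTop (𝓝 t) := by
        simpa using tendsto_const_nhds.sub hzφ
      refine tendsto_of_tendsto_of_tendsto_of_le_of_le' hlow tendsto_const_nhds ?_ ?_
      · filter_upwards [hφ.tendsto_atTop.eventually hzne] with n hn
        have hp : 0 < ‖z (φ n)‖ := norm_pos_iff.2 hn
        have h1 := (div_lt_iff₀ hp).1 (Nat.lt_floor_add_one (t / ‖z (φ n)‖))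
        simp only [m]; linarith
      · filter_upwards [hφ.tendsto_atTop.eventually hzne] with n hn
        have hp : 0 < ‖z (φ n)‖ := norm_pos_iff.2 hn
        exact (le_div_iff₀ hp).1 (Nat.floor_le (div_nonneg ht hp.le))
    have hlim : Filter.Tendsto (fun n => NormedSpace.exp
        (((m n : ℝ) * ‖z (φ n)‖) • ‖z (φ n)‖⁻¹ • z (φ n))) Filter.atTop
        (𝓝 (NormedSpace.exp (t • v))) :=
      (hexp.tendsto _).comp (hm.smul hφv)
    refine hAc.mem_of_tendsto hlim ?_
    filter_upwards [hφ.tendsto_atTop.eventually hzne, hφ.tendsto_atTop.eventually hze] with n hn hen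
    have hpow : ∀ j : ℕ, k (φ n) ^ j ∈ S := by
      intro j
      induction j with
      | zero => simpa using hS1
      | succ j ih => rw [pow_succ]; exact hSm _ ih _ (hkS _)
    refine ⟨k (φ n) ^ m n, hpow _, ?_⟩
    let _ : NormedAlgebra ℚ (W →L[ℂ] W) := NormedAlgebra.restrictScalars ℚ ℂ (W →L[ℂ] W)
    simp only [map_pow, Units.val_pow_eq_pow_val]
    rw [← hen, ← NormedSpace.exp_nsmul, smul_smul, mul_assoc,
      mul_inv_cancel₀ (norm_ne_zero_iff.2 hn), mul_one, Nat.cast_smul_eq_nsmul]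
  have hall : ∀ t : ℝ, ∃ k ∈ S, toGL ρ k = expUnit (t • v) := by
    intro t
    rcases le_total 0 t with ht | ht
    · obtain ⟨k, hk, hke⟩ := hpos t ht
      exact ⟨k, hk, by ext1; exact hke⟩
    · obtain ⟨k, hk, hke⟩ := hpos (-t) (by linarith)
      refine ⟨k⁻¹, hSi k hk, ?_⟩
      have h1 : toGL ρ k = expUnit (-t • v) := by ext1; exact hke
      have h2 : (expUnit (-t • v))⁻¹ = expUnit (t • v) := by
        ext1
        change NormedSpace.exp (-(-t • v)) = NormedSpace.exp (t • v)
        rw [neg_smul, neg_neg]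
      rw [map_inv, h1, h2]
  refine ⟨⟨v, fun t => (hall t).imp fun k hk => hk.2⟩, ?_, hall⟩
  intro h0
  have : v = 0 := congrArg Subtype.val h0
  rw [this, norm_zero] at hv
  exact zero_ne_one hv

/-- At a stable zero of the moment map the stabilizer lies in `K`, because `exp(iσ)` fixes the zero
only for `σ = 0`, and it is a compact group without one-parameter subgroups. -/
theorem finite_stabilizer_of_moment_eq_zero [T2Space F] [IsManifold 𝓘(ℂ, E) ω F]
    (hext : IsHolomorphicExtension ρ E F) (hΩ : IsKaehlerForm Ω) (hμ : IsMomentMap ρ Ω μ) {y : F}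
    (hy : μ y = 0) (hst : AnalyticallyStable μ y) :
    Finite (MulAction.stabilizer (complexification ρ) y) := by
  have hnofix : ∀ s : lieAlg ρ, (∀ ζ : ℂ, expG ρ (ζ • incl ρ s) • y = y) → s = 0 := by
    intro s hs
    by_contra hne
    obtain ⟨t, ht⟩ := (maximalWeight_pos_iff hext hΩ hμ y s).1 (hst s hne)
    rw [weightAt, hs, hy] at ht
    exact lt_irrefl _ ht
  let S : Set K := {k | toComplexification ρ k • y = y}
  let A : Set (W →L[ℂ] W) := (fun k : K => ((toGL ρ k : (W →L[ℂ] W)ˣ) : W →L[ℂ] W)) '' S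
  have hcK : Continuous fun k : K => ((toGL ρ k : (W →L[ℂ] W)ˣ) : W →L[ℂ] W) :=
    continuous_subtype_val.comp ρ.continuous_toFun
  have hmul : ∀ a b : K, toComplexification ρ (a * b) =
      toComplexification ρ a * toComplexification ρ b := fun a b => by
    ext1; exact map_mul (toGL ρ) a b
  have hS1 : (1 : K) ∈ S := by
    have : toComplexification ρ (1 : K) = 1 := by ext1; exact map_one (toGL ρ)
    simp [S, this]
  have hSm : ∀ a ∈ S, ∀ b ∈ S, a * b ∈ S := by
    intro a ha b hb
    change toComplexification ρ (a * b) • y = y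
    rw [hmul, mul_smul, hb, ha]
  have hSi : ∀ a ∈ S, a⁻¹ ∈ S := by
    intro a ha
    change toComplexification ρ a⁻¹ • y = y
    have h1 : toComplexification ρ a⁻¹ = (toComplexification ρ a)⁻¹ := by
      ext1; exact map_inv (toGL ρ) a
    rw [h1, inv_smul_eq_iff]; exact ha.symm
  have hSc : IsCompact S := by
    have h1 : Continuous (toGL ρ) := by
      rw [Units.continuous_iff]
      refine ⟨hcK, ?_⟩
      have h2 : Continuous fun k : K => star ((toGL ρ k : (W →L[ℂ] W)ˣ) : W →L[ℂ] W) := hcK.star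
      exact h2
    have h3 : Continuous (toComplexification ρ) := Continuous.subtype_mk h1 _
    have h4 : Continuous fun k : K => toComplexification ρ k • y :=
      hext.continuous_smul.comp (h3.prodMk continuous_const)
    exact (isClosed_eq h4 continuous_const).isCompact
  -- the identity is isolated in the stabilizer
  obtain ⟨ε, hε, hiso⟩ : ∃ ε > 0, ∀ k ∈ S,
      ‖((toGL ρ k : (W →L[ℂ] W)ˣ) : W →L[ℂ] W) - 1‖ < ε →
        ((toGL ρ k : (W →L[ℂ] W)ˣ) : W →L[ℂ] W) = 1 := by
    by_contra hcon
    push Not at hcon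
    obtain ⟨s, hs0, hs⟩ := exists_lieAlg_of_accumulate hS1 hSm hSi hSc fun ε hε => by
      obtain ⟨k, h1, h2, h3⟩ := hcon ε hε
      exact ⟨k, h1, h3, h2⟩
    refine hs0 (hnofix s fun ζ => smul_eq_of_dmoment_eq_zero hext hΩ hμ
      (dmoment_eq_zero_of_smul_eq hext hμ fun t => ?_) ζ)
    obtain ⟨k, hk, hke⟩ := hs t
    have h1 : toComplexification ρ k = expG ρ (t • inclₗ ρ s) := by ext1; exact hke
    rw [← h1]; exact hk
  have hAfin : A.Finite := by
    have hdisc : DiscreteTopology A := by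
      refine DiscreteTopology.of_forall_le_dist hε ?_
      rintro ⟨_, a, ha, rfl⟩ ⟨_, b, hb, rfl⟩ hab
      by_contra hlt
      rw [not_le, dist_comm] at hlt
      refine hab ?_
      have h1 := hiso (a⁻¹ * b) (hSm _ (hSi a ha) b hb) ?_
      · have h2 : toGL ρ (a⁻¹ * b) = 1 := by ext1; exact h1
        rw [map_mul, map_inv, inv_mul_eq_one] at h2
        ext1
        change ((toGL ρ a : (W →L[ℂ] W)ˣ) : W →L[ℂ] W) = (toGL ρ b : (W →L[ℂ] W)ˣ)
        rw [h2]
      · have h2 : ((toGL ρ (a⁻¹ * b) : (W →L[ℂ] W)ˣ) : W →L[ℂ] W) - 1 =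
            (toGL ρ a⁻¹ : (W →L[ℂ] W)ˣ) * (((toGL ρ b : (W →L[ℂ] W)ˣ) : W →L[ℂ] W) -
              (toGL ρ a : (W →L[ℂ] W)ˣ)) := by
          rw [mul_sub, ← Units.val_mul, ← Units.val_mul, ← map_mul, ← map_mul, inv_mul_cancel,
            map_one, Units.val_one]
        rw [h2]
        refine lt_of_le_of_lt (norm_mul_le _ _) (lt_of_le_of_lt ?_ hlt)
        change _ ≤ dist ((toGL ρ b : (W →L[ℂ] W)ˣ) : W →L[ℂ] W) (toGL ρ a : (W →L[ℂ] W)ˣ)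
        rw [dist_eq_norm]
        exact mul_le_of_le_one_left (norm_nonneg _) (norm_toGL_le ρ _)
    exact (hSc.image hcK).finite ⟨hdisc⟩
  have hsub : ∀ g ∈ MulAction.stabilizer (complexification ρ) y,
      (((g : complexification ρ) : (W →L[ℂ] W)ˣ) : W →L[ℂ] W) ∈ A := by
    intro g hg
    rw [MulAction.mem_stabilizer_iff] at hg
    obtain ⟨k, σ, rfl⟩ := exists_polar g
    have h1 : μ (expG ρ (inclI ρ σ) • y) = 0 := by
      have := moment_smul_eq_zero hμ k⁻¹ (hg.symm ▸ hy)
      rwa [mul_smul, hext.extends_action, inv_smul_smul] at this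
    have h2 : σ = 0 := hnofix σ fun ζ =>
      smul_eq_of_moment_eq_zero hext hΩ hμ (by rw [hy]; rfl) (by rw [h1]; rfl) ζ
    rw [h2, map_zero, expG_zero, mul_one] at hg ⊢
    exact ⟨k, hg, rfl⟩
  have := hAfin.to_subtype
  refine Finite.of_injective (fun g : MulAction.stabilizer (complexification ρ) y =>
    (⟨_, hsub g g.2⟩ : A)) fun g g' h => ?_
  ext1; ext1; ext1
  exact congrArg Subtype.val h

/-- A zero of the moment map with finite stabilizer is stable: all weights vanish at `t = 0`, and a
weight that does not become positive comes from a one-parameter group in the stabilizer. -/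
theorem analyticallyStable_of_moment_eq_zero [T2Space F] [IsManifold 𝓘(ℂ, E) ω F]
    (hext : IsHolomorphicExtension ρ E F) (hΩ : IsKaehlerForm Ω) (hμ : IsMomentMap ρ Ω μ) {y : F}
    (hy : μ y = 0) (hfin : Finite (MulAction.stabilizer (complexification ρ) y)) :
    AnalyticallyStable μ y := by
  intro s hs
  rw [maximalWeight_pos_iff hext hΩ hμ]
  refine ⟨1, lt_of_le_of_ne ?_ fun h1 => hs ?_⟩
  · have := monotone_weightAt hext hΩ hμ y s zero_le_one
    rwa [weightAt_zero, hy] at this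
  · rw [weightAt_eq, one_smul] at h1
    have hfix := smul_eq_of_moment_eq_zero hext hΩ hμ (by rw [hy]; rfl) h1.symm
    -- the continuous curve `exp(ts)` takes finitely many values, so it is constant near `0`
    let A : Set (W →L[ℂ] W) := Set.range fun g : MulAction.stabilizer (complexification ρ) y =>
      (((g : complexification ρ) : (W →L[ℂ] W)ˣ) : W →L[ℂ] W)
    have hA : A.Finite := Set.finite_range _
    have hmem : ∀ t : ℝ, NormedSpace.exp (t • (s : W →L[ℂ] W)) ∈ A := fun t =>
      ⟨⟨expG ρ ((t : ℂ) • incl ρ s), MulAction.mem_stabilizer_iff.2 (hfix t)⟩, rfl⟩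
    have hd := hasDerivAt_exp_smul_const (𝕂 := ℝ) (s : W →L[ℂ] W) (0 : ℝ)
    have hev : ∀ᶠ t : ℝ in 𝓝 0, NormedSpace.exp (t • (s : W →L[ℂ] W)) = 1 := by
      have hcl : IsClosed (A \ {1}) := (hA.subset Set.sdiff_subset).isClosed
      have hn : (A \ {1})ᶜ ∈ 𝓝 (NormedSpace.exp ((0 : ℝ) • (s : W →L[ℂ] W))) :=
        hcl.isOpen_compl.mem_nhds (by simp)
      filter_upwards [hd.continuousAt.preimage_mem_nhds hn] with t ht
      by_contra hne
      exact ht ⟨hmem t, hne⟩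
    have h0 := hd.unique ((hasDerivAt_const (0 : ℝ) (1 : W →L[ℂ] W)).congr_of_eventuallyEq hev)
    ext1
    simpa using h0

theorem finite_stabilizer_smul_iff (g : complexification ρ) (x : F) :
    Finite (MulAction.stabilizer (complexification ρ) (g • x)) ↔
      Finite (MulAction.stabilizer (complexification ρ) x) := by
  rw [MulAction.stabilizer_smul_eq_stabilizer_map_conj]
  exact (((MulAction.stabilizer (complexification ρ) x).equivMapOfInjective _
    (MulAut.conj g).injective).toEquiv.finite_iff).symm

end Stability

end KempfNess

end

theorem mainTheorem2
    -- the Hermitian vector space `W` and the faithful unitary representation `ρ` of `K`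
    {W : Type*} [NormedAddCommGroup W] [InnerProductSpace ℂ W] [FiniteDimensional ℂ W]
    [CompleteSpace W]
    {K : Type*} [Group K] [TopologicalSpace K] [IsTopologicalGroup K] [CompactSpace K]
    (ρ : K →ₜ* unitary (W →L[ℂ] W)) (hρ : Function.Injective ρ)
    -- the Kähler manifold `F`
    {E : Type*} [NormedAddCommGroup E] [NormedSpace ℂ E] [FiniteDimensional ℂ E]
    {F : Type*} [TopologicalSpace F] [T2Space F] [ChartedSpace E F] [IsManifold 𝓘(ℂ, E) ω F]
    (Ω : KempfNess.TwoForm E F) (hΩ : KempfNess.IsKaehlerForm Ω)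
    -- the actions of `K` and of its complexification, and the moment map
    [MulAction K F] [MulAction (KempfNess.complexification ρ) F]
    (hext : KempfNess.IsHolomorphicExtension ρ E F)
    (hK : KempfNess.PreservesForm K Ω)
    (μ : F → Module.Dual ℝ (KempfNess.lieAlg ρ)) (hμ : KempfNess.IsMomentMap ρ Ω μ)
    (x : F) :
    (∀ s : KempfNess.lieAlg ρ, Filter.Tendsto
      (fun t : ℝ => (KempfNess.weightAt μ x s t : EReal)) Filter.atTop
      (𝓝 (KempfNess.maximalWeight μ x s))) ∧
    (KempfNess.zeroOrbits μ x).Subsingleton ∧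
    (KempfNess.AnalyticallyStable μ x ↔
      Finite (MulAction.stabilizer (KempfNess.complexification ρ) x) ∧
        (KempfNess.zeroOrbits μ x).Nonempty) := by
  refine ⟨KempfNess.tendsto_weightAt hext hΩ hμ x,
    KempfNess.zeroOrbits_subsingleton hext hΩ hμ x, fun hx => ?_, ?_⟩
  · obtain ⟨g, hg⟩ := KempfNess.exists_moment_eq_zero hext hΩ hμ hx
    refine ⟨(KempfNess.finite_stabilizer_smul_iff g x).1
      (KempfNess.finite_stabilizer_of_moment_eq_zero hext hΩ hμ hg (hx.smul hext hΩ hμ g)),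
      MulAction.orbit K (g • x), ⟨g • x, rfl⟩, ?_, ?_⟩
    · rintro _ ⟨k, rfl⟩
      exact ⟨KempfNess.toComplexification ρ k * g, by
        simp only [mul_smul, hext.extends_action]⟩
    · rintro _ ⟨k, rfl⟩
      exact KempfNess.moment_smul_eq_zero hμ k hg
  · rintro ⟨hfin, O, ⟨y, rfl⟩, hG, hO⟩
    have hy := hO y (MulAction.mem_orbit_self y)
    obtain ⟨g, hg⟩ := hG (MulAction.mem_orbit_self y)
    change g • x = y at hg
    subst hg
    have := (KempfNess.analyticallyStable_of_moment_eq_zero hext hΩ hμ hy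
      ((KempfNess.finite_stabilizer_smul_iff g x).2 hfin)).smul hext hΩ hμ g⁻¹
    rwa [inv_smul_smul] at this
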